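/- Let $\Bbbk$ be a field of characteristic zero, $\mathbb Z_+=\{0,1,2,\dots\}$, let $(X,\le)$ be a well-ordered set, let $N:X\times X\to\mathbb Z_+$ be an arbitrary function, and write $\partial^{(s)}=\frac1{s!}\partial^s$. **The algebra.** Let $O=\{\partial, L_n^a, R_n^a\mid n\in\mathbb Z_+,\ a\in X\}$, and let $A(X)$ be the associative algebra generated by $O$ with the set $\Sigma_A$ of defining relations $$L_n^a\partial-\partial L_n^a-nL_{n-1}^a,\qquad R_n^a\partial-\partial R_n^a-nR_{n-1}^a,\qquad R_m^bL_n^a-L_n^aR_m^b\qquad(a,b\in X,\ n,m\in\mathbb Z_+).$$ **The module.** Let $M(X,N)$ be the left $A(X)$-module generated by $X$ with the defining relations $$\text{(1)}\quad L_n^a b,\qquad a,b\in X,\ n\ge N(a,b);$$ $$\text{(2)}\quad R_n^b a-\sum_{s=0}^{N(a,b)-n-1}(-1)^{n+s}\,\partial^{(s)}L_{n+s}^a b,\qquad a,b\in X,\ n\in\mathbb Z_+$$ (the sum is empty if $n\ge N(a,b)$). **Normal words.** Let $B(X,N)$ be the set of normal words $$\partial^sL_{n_1}^{a_1}\cdots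 L_{n_k}^{a_k}c,\qquad s,k,n_i\in\mathbb Z_+,\ a_i,c\in X,\quad n_i<N(a_i,a_{i+1})\ (1\le i\le k-1),\quad n_k<N(a_k,c)\ (\text{if }k\ge1),$$ and let $B_0(X,N)\subset B(X,N)$ be the set of those with $s=0$. **The order.** Words in $O$ are compared first by their degree in the letters $R_n^a$, then by the deg-lex order with $\partial<L_n^a<R_m^b$, where $L_n^a<L_m^b$ iff $n<m$, or $n=m$ and $a<b$ (similarly for the letters $R_n^a$). For words $u,v$ in $O$ (possibly empty) and $x,y\in X$ put $ux\prec vy$ iff $u\prec v$, or $u=v$ and $x<y$; moreover every word in $O$ is smaller than every word $vx$. Let $\preceq$ be any monomial order (a well-order compatible with left and right multiplication) on the words in the alphabet $O\,\dot\cup\,X$ which restricts to this order on the words $u$ and $ux$. **Gröbner–Shirshov bases.** The principal word $\bar f$ of a nonzero polynomial $f$ is its greatest word. A set $T$ of monic elements of a free associative algebra is a Gröbner–Shirshov basis (GSB) if for all $f,g\in T$ each composition of inclusion $f-ugv$ (where $w=\bar f=u\bar gv$) and each composition of intersection $fv_2-u_1g$ (where $\bar f=u_1u_2$, $\bar g=u_2v_2$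 with $u_1,u_2,v_2$ nonempty, and $w=u_1u_2v_2$) is a linear combination of elements $u'tv'$ with $t\in T$, $u',v'$ words and $u'\bar tv'\prec w$. Identify $\Bbbk\langle O\rangle\otimes\Bbbk X$ with the span of the words $ux$ ($u$ a word in $O$, $x\in X$) in $\Bbbk\langle O\,\dot\cup\,X\rangle$. A subset $S$ of it is a GSB of $M(X,N)$ if $\Sigma_A$ is a GSB, $S\cup\Sigma_A\cup\{xz\mid x\in X,\ z\in O\,\dot\cup\,X\}$ is a GSB in $\Bbbk\langle O\,\dot\cup\,X\rangle$, and the $A(X)$-submodule generated by $S$ in the free $A(X)$-module on $X$ is the kernel of the projection of this free module onto $M(X,N)$. **Theorem.** The set $\Sigma(X,N)$ which consists of the relations (1), (2) and $$\text{(3)}\quad L_n^aL_m^bu+\sum_{q\ge1}(-1)^q\binom nq L_{n-q}^aL_{m+q}^bu,\qquad a,b\in X,\ n\ge N(a,b),\ m\in\mathbb Z_+,\ u\in B_0(X,N),$$ is a Gröbner–Shirshov basis of the $A(X)$-module $M(X,N)$. Moreover, the words $ux$ ($u$ a word in $O$, $x\in X$) that are reduced, i.e. contain no principal word of an element of $\Sigma(X,N)\cup\Sigma_A$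 as a subword, are exactly the normal words $B(X,N)$. -/

import Mathlib

namespace ConformalGSB

/-! ### Gröbner–Shirshov bases in free associative algebras -/

section FreeAssociative

variable {k Z : Type*} [Field k]

/-- The free associative algebra `k⟨Z⟩`: linear combinations of words in the alphabet `Z`
(the empty word being the identity). -/
abbrev FreeAssoc (k Z : Type*) [Field k] : Type _ := MonoidAlgebra k (FreeMonoid Z)

/-- A word, regarded as an element of the free associative algebra. -/
noncomputable def word (k : Type*) {Z : Type*} [Field k] (w : FreeMonoid Z) : FreeAssoc k Z :=
  MonoidAlgebra.single w 1

/-- `r` (read `r u v` as `u ≺ v`) is a monomial order: a well-order on words which is compatible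
with multiplication on both sides. -/
structure IsMonomialOrder (r : FreeMonoid Z → FreeMonoid Z → Prop) : Prop where
  isWellOrder : IsWellOrder (FreeMonoid Z) r
  mul_mul : ∀ (a b : FreeMonoid Z) {u v : FreeMonoid Z}, r u v → r (a * u * b) (a * v * b)

/-- `w` is the principal (greatest) word of `f`. -/
def IsPrincipal (r : FreeMonoid Z → FreeMonoid Z → Prop) (f : FreeAssoc k Z)
    (w : FreeMonoid Z) : Prop :=
  f.coeff w ≠ 0 ∧ ∀ v, f.coeff v ≠ 0 → v ≠ w → r v w

/-- `f` is monic: it has a principal word, occurring with coefficient `1`. -/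
def IsMonic (r : FreeMonoid Z → FreeMonoid Z → Prop) (f : FreeAssoc k Z) : Prop :=
  ∃ w, IsPrincipal r f w ∧ f.coeff w = 1

/-- `f` is trivial modulo `S` and `w`: it is a linear combination of elements `u s v` with
`s ∈ S`, `u`, `v` words, and `u s̄ v ≺ w`. -/
def IsTrivialMod (r : FreeMonoid Z → FreeMonoid Z → Prop) (S : Set (FreeAssoc k Z))
    (w : FreeMonoid Z) (f : FreeAssoc k Z) : Prop :=
  f ∈ Submodule.span k {h : FreeAssoc k Z | ∃ s ∈ S, ∃ t, IsPrincipal r s t ∧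
    ∃ u v : FreeMonoid Z, r (u * t * v) w ∧ h = word k u * s * word k v}

/-- A set `S` of monic polynomials is a Gröbner–Shirshov basis if all compositions of inclusion
and all compositions of intersection of its elements are trivial. -/
structure IsGSB (r : FreeMonoid Z → FreeMonoid Z → Prop) (S : Set (FreeAssoc k Z)) : Prop where
  monic : ∀ f ∈ S, IsMonic r f
  inclusion : ∀ f ∈ S, ∀ g ∈ S, ∀ p q, IsPrincipal r f p → IsPrincipal r g q →
    ∀ u v : FreeMonoid Z, p = u * q * v → IsTrivialMod r S p (f - word k u * g * word k v)
  intersection : ∀ f ∈ S, ∀ g ∈ S, ∀ p q, IsPrincipal r f p → IsPrincipal r g q →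
    ∀ u₁ u₂ v₂ : FreeMonoid Z, u₁ ≠ 1 → u₂ ≠ 1 → v₂ ≠ 1 → p = u₁ * u₂ → q = u₂ * v₂ →
      IsTrivialMod r S (u₁ * u₂ * v₂) (f * word k v₂ - word k u₁ * g)

/-- A word is `S`-reduced if it contains no principal word of an element of `S` as a subword. -/
def IsReduced (r : FreeMonoid Z → FreeMonoid Z → Prop) (S : Set (FreeAssoc k Z))
    (w : FreeMonoid Z) : Prop :=
  ∀ s ∈ S, ∀ t, IsPrincipal r s t → ∀ u v : FreeMonoid Z, w ≠ u * t * v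

end FreeAssociative

/-! ### Gröbner–Shirshov bases of modules

`O` is the alphabet of the algebra, `X` the alphabet of generators of the module. -/

section Modules

variable {k O X : Type*} [Field k]

/-- `k⟨O⟩ ⊗ kX`, i.e. the free left `k⟨O⟩`-module with basis `X`. -/
abbrev PreMod (k O X : Type*) [Field k] : Type _ := X →₀ FreeAssoc k O

/-- The element `u x` of `k⟨O⟩ ⊗ kX`, for a word `u` in `O` and a generator `x`. -/
noncomputable def modWord (k : Type*) {O X : Type*} [Field k] (u : FreeMonoid O) (x : X) :
    PreMod k O X :=
  Finsupp.single x (word k u)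

/-- A word in `O`, viewed as a word in `O ⊔ X`. -/
def opWord (X : Type*) {O : Type*} (u : FreeMonoid O) : FreeMonoid (O ⊕ X) :=
  FreeMonoid.map Sum.inl u

/-- The word `u x` in the alphabet `O ⊔ X`. -/
def genWord {O X : Type*} (u : FreeMonoid O) (x : X) : FreeMonoid (O ⊕ X) :=
  opWord X u * FreeMonoid.of (Sum.inr x)

/-- The inclusion `k⟨O⟩ → k⟨O ⊔ X⟩`. -/
noncomputable def algIncl (k O X : Type*) [Field k] : FreeAssoc k O →ₐ[k] FreeAssoc k (O ⊕ X) :=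
  MonoidAlgebra.mapDomainAlgHom k k (FreeMonoid.map Sum.inl)

/-- The identification of `k⟨O⟩ ⊗ kX` with the space `k⟨O ⊔ X⟩₁` of combinations of words
`u x`. -/
noncomputable def modIncl (f : PreMod k O X) : FreeAssoc k (O ⊕ X) :=
  f.sum fun x p => algIncl k O X p * word k (FreeMonoid.of (Sum.inr x))

/-- The monomials `x a` and `x y` for `x, y ∈ X`, `a ∈ O`. -/
def nullWords (k O X : Type*) [Field k] : Set (FreeAssoc k (O ⊕ X)) :=
  {h | ∃ (x : X) (z : O ⊕ X), h = word k (FreeMonoid.of (Sum.inr x) * FreeMonoid.of z)}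

/-- `S` is a Gröbner–Shirshov basis in the free module generated by `X` over the algebra
`k⟨O ∣ Sig⟩`: here `Sig` is a GSB of the algebra, and `S ∪ Sig ∪ {xa, xy}` is a GSB in
`k⟨O ⊔ X⟩`. -/
structure IsModuleGSB (r : FreeMonoid (O ⊕ X) → FreeMonoid (O ⊕ X) → Prop)
    (Sig : Set (FreeAssoc k O)) (S : Set (PreMod k O X)) : Prop where
  algebra : IsGSB r (algIncl k O X '' Sig)
  extension : IsGSB r (modIncl '' S ∪ algIncl k O X '' Sig ∪ nullWords k O X)

/-- The associative algebra `k⟨O ∣ Sig⟩`. -/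
def Presented (Sig : Set (FreeAssoc k O)) : Type _ :=
  RingQuot fun f g : FreeAssoc k O => f ∈ Sig ∧ g = 0

noncomputable instance (Sig : Set (FreeAssoc k O)) : Ring (Presented Sig) :=
  inferInstanceAs (Ring (RingQuot fun f g : FreeAssoc k O => f ∈ Sig ∧ g = 0))

noncomputable instance (Sig : Set (FreeAssoc k O)) : Algebra k (Presented Sig) :=
  inferInstanceAs (Algebra k (RingQuot fun f g : FreeAssoc k O => f ∈ Sig ∧ g = 0))

/-- The projection `k⟨O⟩ → k⟨O ∣ Sig⟩`. -/
noncomputable def Presented.mk (Sig : Set (FreeAssoc k O)) : FreeAssoc k O →ₐ[k] Presented Sig :=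
  RingQuot.mkAlgHom k fun f g : FreeAssoc k O => f ∈ Sig ∧ g = 0

/-- The map from `k⟨O⟩ ⊗ kX` onto the free `k⟨O ∣ Sig⟩`-module generated by `X`. -/
noncomputable def toFreeMod (Sig : Set (FreeAssoc k O)) (f : PreMod k O X) :
    X →₀ Presented Sig :=
  f.mapRange (Presented.mk Sig) (map_zero _)

/-- The submodule of the free `k⟨O ∣ Sig⟩`-module on `X` generated by a set `S` of relations.
The module with generators `X` and defining relations `S` is the quotient by it. -/
noncomputable def relSubmodule (Sig : Set (FreeAssoc k O)) (S : Set (PreMod k O X)) :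
    Submodule (Presented Sig) (X →₀ Presented Sig) :=
  Submodule.span (Presented Sig) (toFreeMod Sig '' S)

/-- The left module over `k⟨O ∣ Sig⟩` with generators `X` and defining relations `S`. -/
abbrev PresentedMod (Sig : Set (FreeAssoc k O)) (S : Set (PreMod k O X)) : Type _ :=
  (X →₀ Presented Sig) ⧸ relSubmodule Sig S

/-- `S` is a Gröbner–Shirshov basis of the module `PresentedMod Sig D`: it is a GSB in the free
module, and the submodule it generates is the kernel of the projection of the free module onto
`PresentedMod Sig D`. -/
structure IsGSBOf (r : FreeMonoid (O ⊕ X) → FreeMonoid (O ⊕ X) → Prop)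
    (Sig : Set (FreeAssoc k O)) (D S : Set (PreMod k O X)) : Prop where
  gsb : IsModuleGSB r Sig S
  generates : relSubmodule Sig S =
    LinearMap.ker ((relSubmodule Sig D).mkQ :
      (X →₀ Presented Sig) →ₗ[Presented Sig] PresentedMod Sig D)

end Modules

/-! ### The algebra `A(X)`, the module `M(X, N)` and the order on words -/

/-- The alphabet `O = {∂, L_n^a, R_n^a}`. -/
inductive Op (X : Type*)
  | d : Op X
  | L : ℕ → X → Op X
  | R : ℕ → X → Op X

section Order

variable {X : Type*} [LinearOrder X]

/-- The order on letters: `∂ < L_n^a < R_m^b`, and `L_n^a < L_m^b` iff `n < m`, or `n = m` and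
`a < b`; similarly for the letters `R_n^a`. -/
inductive Op.Lt : Op X → Op X → Prop
  | d_L (n : ℕ) (a : X) : Op.Lt .d (.L n a)
  | d_R (n : ℕ) (a : X) : Op.Lt .d (.R n a)
  | L_R (n m : ℕ) (a b : X) : Op.Lt (.L n a) (.R m b)
  | L_L (n m : ℕ) (a b : X) (h : n < m ∨ n = m ∧ a < b) : Op.Lt (.L n a) (.L m b)
  | R_R (n m : ℕ) (a b : X) (h : n < m ∨ n = m ∧ a < b) : Op.Lt (.R n a) (.R m b)

/-- Whether a letter is one of the `R_n^a`. -/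
def Op.isR : Op X → Bool
  | .R _ _ => true
  | _ => false

/-- The degree of a word in the letters `R_n^a`. -/
def degR (w : FreeMonoid (Op X)) : ℕ := w.toList.countP Op.isR

/-- The order on words in `O`: first by degree in the `R_n^a`, then deg-lex. -/
def OpLt (u v : FreeMonoid (Op X)) : Prop :=
  degR u < degR v ∨ degR u = degR v ∧ List.Shortlex Op.Lt u.toList v.toList

/-- `r`, an order on words in `O ⊔ X`, restricts to the prescribed order on the words
`u` and `u x` with `u` a word in `O`, `x ∈ X`. -/
structure IsPrescribed (r : FreeMonoid (Op X ⊕ X) → FreeMonoid (Op X ⊕ X) → Prop) : Prop where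
  op_op : ∀ u v, r (opWord X u) (opWord X v) ↔ OpLt u v
  gen_gen : ∀ u v x y, r (genWord u x) (genWord v y) ↔ OpLt u v ∨ u = v ∧ x < y
  op_gen : ∀ u v x, r (opWord X u) (genWord v x)

end Order

section Relations

variable (k : Type*) {X : Type*} [Field k]

/-- The letter `o` as an element of `k⟨O⟩`. -/
noncomputable def letter (o : Op X) : FreeAssoc k (Op X) := word k (FreeMonoid.of o)

/-- Defining relations of `A(X)`:
`L_n^a ∂ - ∂ L_n^a - n L_{n-1}^a`, `R_n^a ∂ - ∂ R_n^a - n R_{n-1}^a`,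
`R_m^b L_n^a - L_n^a R_m^b`. (For `n = 0` the terms with factor `n` vanish.) -/
inductive AlgRel : FreeAssoc k (Op X) → Prop
  | L_d (n : ℕ) (a : X) : AlgRel (letter k (.L n a) * letter k .d
      - letter k .d * letter k (.L n a) - (n : k) • letter k (.L (n - 1) a))
  | R_d (n : ℕ) (a : X) : AlgRel (letter k (.R n a) * letter k .d
      - letter k .d * letter k (.R n a) - (n : k) • letter k (.R (n - 1) a))
  | R_L (n m : ℕ) (a b : X) : AlgRel (letter k (.R m b) * letter k (.L n a)
      - letter k (.L n a) * letter k (.R m b))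

/-- The set of defining relations of `A(X)`. -/
def algRels (X : Type*) : Set (FreeAssoc k (Op X)) := {f | AlgRel k f}

/-- The word `L_{n_1}^{a_1} ⋯ L_{n_k}^{a_k}` for the list `(n_1, a_1), …, (n_k, a_k)`. -/
def lWord {X : Type*} (l : List (ℕ × X)) : FreeMonoid (Op X) :=
  FreeMonoid.ofList (l.map fun p => Op.L p.1 p.2)

/-- For the word `L_{n_1}^{a_1} ⋯ L_{n_k}^{a_k} c`, the condition `n_i < N(a_i, a_{i+1})` for
`i < k` and `n_k < N(a_k, c)`. -/
def IsNormalSeq {X : Type*} (N : X → X → ℕ) : List (ℕ × X) → X → Prop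
  | [], _ => True
  | [(n, a)], c => n < N a c
  | (n, a) :: (m, b) :: l, c => n < N a b ∧ IsNormalSeq N ((m, b) :: l) c

/-- The set `B(X, N)` of normal words `∂^s L_{n_1}^{a_1} ⋯ L_{n_k}^{a_k} c`, as words in the
alphabet `O ⊔ X`. -/
def normalWords {X : Type*} (N : X → X → ℕ) : Set (FreeMonoid (Op X ⊕ X)) :=
  {w | ∃ (s : ℕ) (l : List (ℕ × X)) (c : X), IsNormalSeq N l c ∧
    w = genWord (FreeMonoid.of Op.d ^ s * lWord l) c}

/-- The locality relations `L_n^a b`, `n ≥ N(a, b)`. -/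
def localityRels (N : X → X → ℕ) : Set (PreMod k (Op X) X) :=
  {f | ∃ (a b : X) (n : ℕ), N a b ≤ n ∧ f = modWord k (FreeMonoid.of (Op.L n a)) b}

/-- The relations `R_n^b a - ∑_{s=0}^{N(a,b)-n-1} (-1)^{n+s} ∂^{(s)} L_{n+s}^a b`, where
`∂^{(s)} = ∂^s / s!`. -/
def rightRels (N : X → X → ℕ) : Set (PreMod k (Op X) X) :=
  {f | ∃ (a b : X) (n : ℕ), f = modWord k (FreeMonoid.of (Op.R n b)) a
    - ∑ s ∈ Finset.range (N a b - n), ((-1) ^ (n + s) * (s.factorial : k)⁻¹) •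
        modWord k (FreeMonoid.of Op.d ^ s * FreeMonoid.of (Op.L (n + s) a)) b}

/-- The relations `L_n^a L_m^b u + ∑_{q ≥ 1} (-1)^q binom(n, q) L_{n-q}^a L_{m+q}^b u`,
where `n ≥ N(a, b)` and `u = L_{n_1}^{a_1} ⋯ L_{n_k}^{a_k} c` is a `∂`-free normal word. -/
def extraRels (N : X → X → ℕ) : Set (PreMod k (Op X) X) :=
  {f | ∃ (a b : X) (n m : ℕ) (l : List (ℕ × X)) (c : X), N a b ≤ n ∧ IsNormalSeq N l c ∧
    f = modWord k (lWord ((n, a) :: (m, b) :: l)) c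
      + ∑ q ∈ Finset.Icc 1 n, ((-1) ^ q * (n.choose q : k)) •
          modWord k (lWord ((n - q, a) :: (m + q, b) :: l)) c}

/-- The defining relations of the `A(X)`-module `M(X, N)`. -/
def moduleRels (N : X → X → ℕ) : Set (PreMod k (Op X) X) :=
  localityRels k N ∪ rightRels k N

/-- The set of relations `Σ(X, N)`. -/
def gsbRels (N : X → X → ℕ) : Set (PreMod k (Op X) X) :=
  localityRels k N ∪ rightRels k N ∪ extraRels k N

end Relations

/-! ### Existence of an order as prescribed -/

section Existence

variable {X : Type*} [LinearOrder X]

/-- A number attached to a letter: `0` for `∂`, `1` for `L_n^a`, `2` for `R_n^a`. -/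
def Op.key {X : Type*} : Op X → ℕ ×ₗ ℕ ×ₗ WithBot X
  | .d => toLex (0, toLex (0, ⊥))
  | .L n a => toLex (1, toLex (n, (a : WithBot X)))
  | .R n a => toLex (2, toLex (n, (a : WithBot X)))

theorem Op.key_injective {X : Type*} : Function.Injective (Op.key : Op X → _) := by
  intro a b h
  cases a <;> cases b <;> simp_all [Op.key]

theorem Op.lt_iff_key (a b : Op X) : Op.Lt a b ↔ a.key < b.key := by
  constructor
  · intro h
    cases h <;> simp_all [Op.key, Prod.Lex.toLex_lt_toLex]
  · intro h
    cases a <;> cases b <;> simp_all [Op.key, Prod.Lex.toLex_lt_toLex] <;>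
      constructor <;> assumption

theorem Op.lt_isWellOrder [WellFoundedLT X] : IsWellOrder (Op X) Op.Lt := by
  have h : (Op.Lt : Op X → Op X → Prop) = InvImage (· < ·) Op.key := by
    funext a b; exact propext (Op.lt_iff_key a b)
  refine { wf := ?_, trichotomous := ?_ }
  · rw [h]; exact InvImage.wf _ wellFounded_lt
  · intro a b h1 h2
    rw [Op.lt_iff_key] at h1 h2
    exact Op.key_injective (le_antisymm (not_lt.1 h2) (not_lt.1 h1))

/-- An order on all words in `O ⊔ X`: by degree in `X`, then by degree in the `R_n^a`, then
deg-lex. -/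
def WordLt (u v : FreeMonoid (Op X ⊕ X)) : Prop :=
  InvImage (Prod.Lex (· < ·) (Prod.Lex (· < ·) (List.Shortlex (Sum.Lex Op.Lt (· < ·)))))
    (fun w : FreeMonoid (Op X ⊕ X) => (w.toList.countP Sum.isRight,
      w.toList.countP (Sum.elim Op.isR fun _ => false), w.toList)) u v

theorem wordLt_iff (u v : FreeMonoid (Op X ⊕ X)) : WordLt u v ↔
    u.toList.countP Sum.isRight < v.toList.countP Sum.isRight ∨
    u.toList.countP Sum.isRight = v.toList.countP Sum.isRight ∧
    (u.toList.countP (Sum.elim Op.isR fun _ => false) <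
      v.toList.countP (Sum.elim Op.isR fun _ => false) ∨
    u.toList.countP (Sum.elim Op.isR fun _ => false) =
      v.toList.countP (Sum.elim Op.isR fun _ => false) ∧
      List.Shortlex (Sum.Lex Op.Lt (· < ·)) u.toList v.toList) := by
  simp only [WordLt, InvImage, Prod.lex_def]

theorem lex_append_right {α : Type*} {r : α → α → Prop} {s t : List α} (h : List.Lex r s t)
    (hl : s.length = t.length) (l : List α) : List.Lex r (s ++ l) (t ++ l) := by
  induction h with
  | nil => simp at hl
  | cons _ ih => exact List.Lex.cons (ih (by simpa using hl))
  | rel h => exact List.Lex.rel h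

theorem lex_map_inl {α β : Type*} {r : α → α → Prop} {q : β → β → Prop} (s t : List α) :
    List.Lex (Sum.Lex r q) (s.map Sum.inl) (t.map Sum.inl) ↔ List.Lex r s t := by
  constructor
  · intro h
    induction s generalizing t with
    | nil => cases t with
      | nil => cases h
      | cons b t => exact List.Lex.nil
    | cons a s ih => cases t with
      | nil => cases h
      | cons b t =>
        rw [List.map_cons, List.map_cons] at h
        generalize ha : (Sum.inl a : α ⊕ β) = a' at h
        generalize hb : (Sum.inl b : α ⊕ β) = b' at h
        cases h with
        | cons h => cases Sum.inl_injective (ha.trans hb.symm); exact List.Lex.cons (ih _ h)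
        | rel h => subst ha hb; exact List.Lex.rel (Sum.lex_inl_inl.1 h)
  · intro h
    induction h with
    | nil => exact List.Lex.nil
    | cons _ ih => exact List.Lex.cons ih
    | rel h => exact List.Lex.rel (Sum.lex_inl_inl.2 h)

theorem lex_append_singleton {α : Type*} {r : α → α → Prop} [Std.Irrefl r] {s t : List α}
    (hl : s.length = t.length) (x y : α) :
    List.Lex r (s ++ [x]) (t ++ [y]) ↔ List.Lex r s t ∨ s = t ∧ r x y := by
  induction s generalizing t with
  | nil =>
    obtain rfl : t = [] := List.length_eq_zero_iff.1 hl.symm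
    simp
  | cons a s ih => cases t with
    | nil => simp at hl
    | cons b t =>
      have hl' : s.length = t.length := by simpa using hl
      simp only [List.cons_append, List.cons.injEq]
      constructor
      · intro h
        cases h with
        | cons h =>
          rcases (ih hl').1 h with h | ⟨h, h'⟩
          · exact Or.inl (List.Lex.cons h)
          · exact Or.inr ⟨⟨rfl, h⟩, h'⟩
        | rel h => exact Or.inl (List.Lex.rel h)
      · rintro (h | ⟨⟨rfl, rfl⟩, h⟩)
        · cases h with
          | cons h => exact List.Lex.cons ((ih hl').2 (Or.inl h))
          | rel h => exact List.Lex.rel h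
        · exact List.Lex.cons ((ih rfl).2 (Or.inr ⟨rfl, h⟩))

theorem isMonomialOrder_wordLt [WellFoundedLT X] :
    IsMonomialOrder (WordLt : FreeMonoid (Op X ⊕ X) → _ → Prop) := by
  have : IsWellOrder (Op X) Op.Lt := Op.lt_isWellOrder
  refine ⟨{ wf := ?_, trichotomous := ?_ }, ?_⟩
  · have := InvImage.wf (fun w : FreeMonoid (Op X ⊕ X) => (w.toList.countP Sum.isRight,
      w.toList.countP (Sum.elim Op.isR fun _ => false), w.toList)) (WellFounded.prod_lex wellFounded_lt (WellFounded.prod_lex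
      wellFounded_lt (List.Shortlex.wf (Sum.lex_wf this.wf (wellFounded_lt (α := X))))))
    exact this
  · intro u v h1 h2
    rw [wordLt_iff] at h1 h2
    push Not at h1 h2
    have e1 := le_antisymm h2.1 h1.1
    have e2 := le_antisymm (h2.2 e1.symm).1 (h1.2 e1).1
    have : Std.Trichotomous (List.Shortlex (Sum.Lex (Op.Lt : Op X → _) (· < · : X → _ → Prop))) :=
      inferInstance
    exact FreeMonoid.toList.injective (this.trichotomous _ _ ((h1.2 e1).2 e2)
      ((h2.2 e1.symm).2 e2.symm))
  · intro a b u v h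
    rw [wordLt_iff] at h ⊢
    simp only [FreeMonoid.toList_mul, List.countP_append, add_lt_add_iff_left,
      add_lt_add_iff_right, add_left_inj, add_right_inj]
    rcases h with h | ⟨h, h' | ⟨h', h''⟩⟩
    · exact Or.inl h
    · exact Or.inr ⟨h, Or.inl h'⟩
    · refine Or.inr ⟨h, Or.inr ⟨h', ?_⟩⟩
      rcases List.shortlex_def.1 h'' with hl | ⟨hl, hx⟩
      · exact List.Shortlex.of_length_lt (by simpa using hl)
      · refine List.Shortlex.of_lex (by simp [hl]) ?_
        have h3 : List.Lex (Sum.Lex Op.Lt (· < ·)) (u.toList ++ b.toList)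
            (v.toList ++ b.toList) := by
          exact lex_append_right hx hl _
        rw [List.append_assoc, List.append_assoc]
        exact List.Lex.append_left _ h3 _

theorem isPrescribed_wordLt [WellFoundedLT X] :
    IsPrescribed (WordLt : FreeMonoid (Op X ⊕ X) → _ → Prop) := by
  have hw : IsWellOrder (Op X) Op.Lt := Op.lt_isWellOrder
  have hX : ∀ u : List (Op X), (u.map (Sum.inl : Op X → Op X ⊕ X)).countP Sum.isRight = 0 := by
    intro u; simp [List.countP_map, Function.comp_def]
  have hR : ∀ u : List (Op X), (u.map (Sum.inl : Op X → Op X ⊕ X)).countP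
      (Sum.elim Op.isR fun _ => false) = u.countP Op.isR := by
    intro u; simp [List.countP_map, Function.comp_def]
  refine ⟨?_, ?_, ?_⟩
  · intro u v
    rw [wordLt_iff, OpLt]
    simp only [opWord, FreeMonoid.toList_map, hX, hR, List.shortlex_def, List.length_map,
      lex_map_inl, degR]
    simp
  · intro u v x y
    rw [wordLt_iff, OpLt]
    simp only [genWord, opWord, FreeMonoid.toList_map, FreeMonoid.toList_mul,
      FreeMonoid.toList_of, List.countP_append, hX, hR, List.shortlex_def, List.length_append,
      List.length_map, degR]
    by_cases hl : u.toList.length = v.toList.length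
    · rw [lex_append_singleton (by simpa using hl), lex_map_inl]
      have : u.toList.map (Sum.inl : Op X → Op X ⊕ X) = v.toList.map Sum.inl ↔ u = v := by
        rw [(List.map_injective_iff.2 Sum.inl_injective).eq_iff, FreeMonoid.toList.injective.eq_iff]
      rw [this]
      simp [hl]
      grind
    · have : u ≠ v := by rintro rfl; exact hl rfl
      simp [hl, this]
  · intro u v x
    rw [wordLt_iff]
    left
    simp [genWord, opWord, hX]

end Existence

end ConformalGSB

/-! Two facts carry the proof: the extra relations already hold in $M(X,N)$, and the normal words
are linearly independent in some module where all the relations hold.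

For the first, $R$ commutes with $L$, so $L_n^aR_m^cb=R_m^cL_n^ab=0$ for $n\ge N(a,b)$. Expanding
$R_m^cb$ in the words $\partial^{(s)}L_{m+s}^bc$ and moving $L_n^a$ past $\partial^{(s)}$ gives, by
descending induction on $m$, that the $n$-th difference of $L^aL^b$ kills $c$. In the same way
$R_p^ca'$ trades one generator for $L_{p+s}^{a'}c$, and an induction on the length of $u$ gives the
relation on $uc$ (`IsGenRep.diffOp_lProd`). Hence both sets of relations generate the same submodule
(`relSubmodule_gsbRels`).

For the second, take an algebra $E$ with an element $T$ and elements $\kappa_n(a)$ such that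
$\kappa_{n+1}(a)=[T,\kappa_n(a)]$ and $\kappa_n(a)T^m\kappa_0(b)=0$ for $n\ge N(a,b)$. Sequences in
$E$ form a module over $A(X)$ in which $a\mapsto(T^p\kappa_0(a))_p$ satisfies the defining relations
(`isGenRep_seq`). For $E$ take the operators on the span of lists of pairs (exponent, generator):
$\kappa_n(a)$ prepends $(n,a)$ or gives zero, and $T$ raises one exponent in all ways. Applied to
the empty list, a normal word gives the list of its letters plus lexicographically smaller lists,
whence `linearIndependent_normal`.

The two facts meet in `isGSB_of_map_eq_zero`. A composition reduces, below its word $w$, to a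
combination of reduced words; a linear map that kills the ideal and is injective on reduced words
shows this combination to be zero. No composition of module relations has to be computed. This works
for words containing a generator; the remaining compositions involve $\Sigma_A$ alone, whose only
proper overlap is $R_m^bL_n^a\partial$ (`isGSB_algRels`). -/

set_option maxSynthPendingDepth 3

namespace ConformalGSB

/-! ### Consequences of the defining relations in an arbitrary representation. -/

section Representations

variable {k : Type*} [Field k]

/-- Iterated difference of the products `A i * B m`:
`∑ q, (-1) ^ q * n.choose q * (A (i + n - q) * B (m + q))`. -/
def diffOp {E : Type*} [Ring E] (A B : ℕ → E) : ℕ → ℕ → ℕ → E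
  | 0, i, m => A i * B m
  | n + 1, i, m => diffOp A B n (i + 1) m - diffOp A B n i (m + 1)

section Algebra

variable {E : Type*} [Ring E] [Algebra k E]

/-- Pascal's rule. For `i = 0` the right side is the operator in the extra relations; the recursive
form is the one that suits commutators. -/
theorem diffOp_eq_sum (A B : ℕ → E) (n i m : ℕ) : diffOp A B n i m =
    ∑ q ∈ Finset.range (n + 1), ((-1) ^ q * (n.choose q : k)) • (A (i + n - q) * B (m + q)) := by
  induction n generalizing i m with
  | zero => simp [diffOp]
  | succ n ih =>
    rw [diffOp, ih, ih, Finset.sum_range_succ' _ (n + 1)]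
    -- The sum may be extended to `q = n + 1`, where the binomial vanishes; splitting off `q = 0`
    -- then shifts the index.
    have h1 : ∑ q ∈ Finset.range (n + 1), ((-1) ^ q * (n.choose q : k)) •
        (A (i + 1 + n - q) * B (m + q)) = ∑ q ∈ Finset.range (n + 1),
          ((-1) ^ (q + 1) * (n.choose (q + 1) : k)) • (A (i + n - q) * B (m + (q + 1))) +
          A (i + 1 + n) * B m := by
      have := Finset.sum_range_succ (fun q => ((-1) ^ q * (n.choose q : k)) •
        (A (i + 1 + n - q) * B (m + q))) (n + 1)
      rw [Nat.choose_succ_self, Nat.cast_zero, mul_zero, zero_smul, add_zero] at this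
      rw [← this, Finset.sum_range_succ' _ (n + 1)]
      simp only [pow_zero, Nat.choose_zero_right, Nat.cast_one, mul_one, one_smul, Nat.sub_zero,
        add_zero]
      congr 1
      refine Finset.sum_congr rfl fun q _ => ?_
      rw [show i + 1 + n - (q + 1) = i + n - q by omega]
    rw [h1, add_sub_right_comm, ← Finset.sum_sub_distrib]
    congr 1
    · refine Finset.sum_congr rfl fun q _ => ?_
      rw [show i + (n + 1) - (q + 1) = i + n - q by omega, show m + 1 + q = m + (q + 1) by omega,
        ← sub_smul, Nat.choose_succ_succ]
      congr 1
      push_cast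
      ring
    · simp [show i + (n + 1) = i + 1 + n by omega]

/-- Commuting with `D` lowers `i` or `m` but never the order `n`. With `i = 0` the differences of
order `n` are thus closed under commutation with `D`. -/
theorem diffOp_mul_comm {A B : ℕ → E} {D : E}
    (hA : ∀ n, A n * D = D * A n + (n : k) • A (n - 1))
    (hB : ∀ n, B n * D = D * B n + (n : k) • B (n - 1)) (n i m : ℕ) :
    diffOp A B n i m * D = D * diffOp A B n i m + (i : k) • diffOp A B n (i - 1) m +
      (m : k) • diffOp A B n i (m - 1) := by
  induction n generalizing i m with
  | zero =>
    simp only [diffOp]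
    rw [mul_assoc, hB, mul_add, ← mul_assoc, hA, add_mul, mul_assoc, smul_mul_assoc,
      mul_smul_comm]
  | succ n ih =>
    simp only [diffOp]
    rw [sub_mul, ih, ih]
    simp only [Nat.add_sub_cancel, Nat.cast_add, Nat.cast_one, mul_sub]
    rcases i with _ | i <;> rcases m with _ | m <;>
      simp only [Nat.add_sub_cancel, Nat.cast_add, Nat.cast_one, Nat.cast_zero, add_smul,
        zero_smul, one_smul, zero_add, smul_sub] <;> abel

/-- The divided power `D ^ s / s!`. -/
noncomputable def dividedPow (k : Type*) [Field k] {E : Type*} [Ring E] [Algebra k E] (D : E)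
    (s : ℕ) : E := (s.factorial : k)⁻¹ • D ^ s

theorem dividedPow_mul_self [CharZero k] (D : E) (s : ℕ) :
    dividedPow k D s * D = ((s + 1 : ℕ) : k) • dividedPow k D (s + 1) := by
  have h1 : ((s + 1 : ℕ) : k) ≠ 0 := Nat.cast_ne_zero.2 s.succ_ne_zero
  rw [dividedPow, dividedPow, smul_mul_assoc, ← pow_succ, smul_smul, Nat.factorial_succ,
    Nat.cast_mul, mul_inv, mul_inv_cancel_left₀ h1]

theorem mul_dividedPow [CharZero k] {A : ℕ → E} {D : E}
    (hA : ∀ n, A n * D = D * A n + (n : k) • A (n - 1)) (n s : ℕ) :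
    A n * dividedPow k D s = ∑ t ∈ Finset.range (s + 1),
      (n.choose (s - t) : k) • (dividedPow k D t * A (n - (s - t))) := by
  rw [← Finset.Nat.sum_antidiagonal_eq_sum_range_succ
    (fun j t => (n.choose t : k) • (dividedPow k D j * A (n - t)))]
  induction s with
  | zero => simp [dividedPow]
  | succ s ih =>
    have h1 : ((s + 1 : ℕ) : k) ≠ 0 := Nat.cast_ne_zero.2 s.succ_ne_zero
    refine smul_right_injective E h1 ?_
    dsimp only
    rw [← mul_smul_comm, ← dividedPow_mul_self, ← mul_assoc, ih, Finset.sum_mul, Finset.smul_sum]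
    -- After multiplication by `s + 1`, this factor splits as `p.1 + p.2`: the first part matches
    -- the terms where the new `D` joins the divided power, the second those where it lowers the
    -- index of `A`.
    have key : ∀ p ∈ Finset.HasAntidiagonal.antidiagonal (s + 1), ((s + 1 : ℕ) : k) •
        ((n.choose p.2 : k) • (dividedPow k D p.1 * A (n - p.2))) =
        (n.choose p.2 : k) • ((p.1 : k) • dividedPow k D p.1 * A (n - p.2)) +
        ((p.2 : k) * (n.choose p.2 : k)) • (dividedPow k D p.1 * A (n - p.2)) := by
      intro p hp
      rw [← Finset.HasAntidiagonal.mem_antidiagonal.1 hp]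
      simp only [smul_mul_assoc, smul_smul, ← add_smul]
      congr 1
      push_cast
      ring
    rw [Finset.sum_congr rfl key, Finset.sum_add_distrib, Finset.Nat.sum_antidiagonal_succ,
      Finset.Nat.sum_antidiagonal_succ' (f := fun p => ((p.2 : k) * (n.choose p.2 : k)) •
        (dividedPow k D p.1 * A (n - p.2)))]
    simp only [Nat.cast_zero, zero_smul, zero_mul, smul_zero, zero_add]
    rw [← Finset.sum_add_distrib]
    refine Finset.sum_congr rfl fun p _ => ?_
    rw [← dividedPow_mul_self, smul_mul_assoc, mul_assoc, hA, mul_add, smul_add, mul_assoc]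
    congr 1
    rw [mul_smul_comm, smul_smul, Nat.sub_sub, ← Nat.cast_mul, ← Nat.cast_mul]
    congr 2
    have := Nat.choose_succ_right_eq n p.2
    rw [mul_comm (p.2 + 1), this]

end Algebra

/-- Operators `D`, `L n a`, `R n a` subject to the defining relations of `A(X)`. -/
structure IsOpRep {E X : Type*} [Ring E] [Algebra k E] (D : E) (L R : ℕ → X → E) : Prop where
  L_d : ∀ n a, L n a * D = D * L n a + (n : k) • L (n - 1) a
  R_d : ∀ n a, R n a * D = D * R n a + (n : k) • R (n - 1) a
  R_L : ∀ n m a b, R m b * L n a = L n a * R m b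

/-- The elements `g x` of a representation of `A(X)` satisfy the defining relations of
`M(X, N)`. -/
structure IsGenRep {V X : Type*} [AddCommGroup V] [Module k V] (N : X → X → ℕ)
    (D : Module.End k V) (L R : ℕ → X → Module.End k V) (g : X → V) : Prop
    extends IsOpRep (k := k) D L R where
  locality : ∀ a b n, N a b ≤ n → L n a (g b) = 0
  right : ∀ a b n, R n b (g a) = ∑ s ∈ Finset.range (N a b - n),
    (-1 : k) ^ (n + s) • dividedPow k D s (L (n + s) a (g b))

/-- The operator `L_{n_1}^{a_1} ⋯ L_{n_k}^{a_k}`. -/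
def lProd {E X : Type*} [Ring E] (L : ℕ → X → E) (l : List (ℕ × X)) : E :=
  (l.map fun p => L p.1 p.2).prod

/-- The commutator only lowers single indices, so the length is preserved; this permits an induction
on length with all indices free. -/
theorem lProd_mul_comm {E X : Type*} [Ring E] [Algebra k E] {L : ℕ → X → E} {D : E}
    (h : ∀ n a, L n a * D = D * L n a + (n : k) • L (n - 1) a) (l : List (ℕ × X)) :
    lProd L l * D - D * lProd L l ∈
      Submodule.span k (lProd L '' {l' | l'.length = l.length}) := by
  induction l with
  | nil => simp [lProd]
  | cons p l ih =>
    have hp : ∀ l, lProd L (p :: l) = L p.1 p.2 * lProd L l := fun l => by simp [lProd]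
    have e : lProd L (p :: l) * D - D * lProd L (p :: l) =
        L p.1 p.2 * (lProd L l * D - D * lProd L l) + (p.1 : k) • lProd L ((p.1 - 1, p.2) :: l) := by
      have : lProd L ((p.1 - 1, p.2) :: l) = L (p.1 - 1) p.2 * lProd L l := by simp [lProd]
      rw [this, hp, mul_sub, ← mul_assoc _ D, h, ← smul_mul_assoc, add_mul]
      simp only [mul_assoc]
      abel
    rw [e]
    refine add_mem ?_ (Submodule.smul_mem _ _ (Submodule.subset_span ⟨_, by simp, rfl⟩))
    have := Submodule.mem_map_of_mem (f := LinearMap.mulLeft k (L p.1 p.2)) ih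
    rw [Submodule.map_span] at this
    refine Submodule.span_mono ?_ this
    rintro _ ⟨_, ⟨l', hl', rfl⟩, rfl⟩
    exact ⟨p :: l', by simpa using hl', hp l'⟩

variable {V X : Type*} [AddCommGroup V] [Module k V]

/-- If `A n` kills the combinations `∑ (-1) ^ s D ^ s / s! B (m + s) v`, then the difference
operators of order `n` kill `v`. -/
theorem diffOp_apply_eq_zero [CharZero k] {A B : ℕ → Module.End k V} {D : Module.End k V}
    (hA : ∀ n, A n * D = D * A n + (n : k) • A (n - 1)) {v : V} {M : ℕ}
    (hM : ∀ m, M ≤ m → B m v = 0) {n : ℕ}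
    (h : ∀ m, A n (∑ s ∈ Finset.range (M - m), (-1 : k) ^ (m + s) •
      dividedPow k D s (B (m + s) v)) = 0) (m : ℕ) : diffOp A B n 0 m v = 0 := by
  -- Descending induction on `m`, starting from `m ≥ M`, where every `B (m + q) v` vanishes.
  suffices H : ∀ j m, M ≤ m + j → diffOp A B n 0 m v = 0 from H M m (Nat.le_add_left _ _)
  intro j
  induction j with
  | zero =>
    intro m hm
    rw [diffOp_eq_sum (k := k), LinearMap.sum_apply]
    refine Finset.sum_eq_zero fun q _ => ?_
    rw [LinearMap.smul_apply, Module.End.mul_apply, hM _ (by omega), map_zero, smul_zero]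
  | succ j ih =>
    intro m hm
    by_cases hmM : M ≤ m
    · exact ih m (by omega)
    have h1 := h m
    have e : A n (∑ s ∈ Finset.range (M - m), (-1 : k) ^ (m + s) •
      dividedPow k D s (B (m + s) v)) = (-1 : k) ^ m • ∑ s ∈ Finset.range (M - m),
        (-1 : k) ^ s • dividedPow k D s (diffOp A B n 0 (m + s) v) := by
      rw [map_sum, Finset.smul_sum]
      -- In `f j t`, out of `j + t` factors `D`, `j` remain on the left and `t` were absorbed into
      -- the index of `A`. Summing over `t` first produces the difference operator.
      set f : ℕ → ℕ → V := fun j t => (-1 : k) ^ (m + (j + t)) • (n.choose t : k) •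
        dividedPow k D j (A (n - t) (B (m + (j + t)) v)) with hf
      have e1 : ∀ s ∈ Finset.range (M - m), A n ((-1 : k) ^ (m + s) •
          dividedPow k D s (B (m + s) v)) = ∑ t ∈ Finset.range (s + 1), f t (s - t) := by
        intro s _
        rw [map_smul, ← Module.End.mul_apply, mul_dividedPow hA, LinearMap.sum_apply,
          Finset.smul_sum]
        refine Finset.sum_congr rfl fun t ht => ?_
        have : t + (s - t) = s := by have := Finset.mem_range.1 ht; omega
        simp [hf, this]
      rw [Finset.sum_congr rfl e1, Finset.sum_range_diag_flip]
      refine Finset.sum_congr rfl fun j hj => ?_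
      have e2 : ∑ t ∈ Finset.range (M - m - j), f j t = ∑ t ∈ Finset.range (n + 1), f j t := by
        have a1 : ∀ t, n + 1 ≤ t → f j t = 0 := fun t ht => by
          simp [hf, Nat.choose_eq_zero_of_lt ht]
        have a2 : ∀ t, M - m - j ≤ t → f j t = 0 := fun t ht => by
          simp only [hf]
          rw [hM _ (by omega)]
          simp
        rcases le_total (n + 1) (M - m - j) with hle | hle
        · symm
          refine Finset.sum_subset (Finset.range_mono hle) fun t _ ht => a1 t ?_
          simpa using ht
        · refine Finset.sum_subset (Finset.range_mono hle) fun t _ ht => a2 t ?_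
          simpa using ht
      rw [e2, diffOp_eq_sum (k := k), LinearMap.sum_apply, map_sum, Finset.smul_sum,
        Finset.smul_sum]
      refine Finset.sum_congr rfl fun t _ => ?_
      simp only [hf, LinearMap.smul_apply, Module.End.mul_apply, map_smul, smul_smul, zero_add,
        add_assoc]
      congr 1
      ring
    -- All terms with `s ≥ 1` vanish by induction, which isolates the term `s = 0`.
    rw [e, show M - m = (M - m - 1) + 1 by omega, Finset.sum_range_succ', Finset.sum_eq_zero,
      zero_add] at h1
    · simpa [dividedPow] using h1
    · intro s _
      rw [ih (m + (s + 1)) (by omega), map_zero, smul_zero]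

/-- The extra relations follow from the defining ones because right operators commute with all left
ones and express one generator through another. Normality of the word `l` plays no role. The
induction on length runs over all generators `c` at once. -/
theorem IsGenRep.diffOp_lProd [CharZero k] {N : X → X → ℕ} {D : Module.End k V}
    {L R : ℕ → X → Module.End k V} {g : X → V} (h : IsGenRep N D L R g) {a b : X} {n : ℕ}
    (hn : N a b ≤ n) (m : ℕ) (l : List (ℕ × X)) (c : X) :
    diffOp (L · a) (L · b) n 0 m (lProd L l (g c)) = 0 := by
  set F : ℕ → Module.End k V := diffOp (L · a) (L · b) n 0 with hF
  have hRF : ∀ p c m, R p c * F m = F m * R p c := by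
    intro p c m
    rw [hF, diffOp_eq_sum (k := k), Finset.mul_sum, Finset.sum_mul]
    refine Finset.sum_congr rfl fun q _ => ?_
    rw [mul_smul_comm, smul_mul_assoc, ← mul_assoc, h.R_L, mul_assoc, h.R_L, mul_assoc]
  have hRl : ∀ p c l, R p c * lProd L l = lProd L l * R p c := by
    intro p c l
    induction l with
    | nil => simp [lProd]
    | cons q l ih =>
      have hp : lProd L (q :: l) = L q.1 q.2 * lProd L l := by simp [lProd]
      rw [hp, ← mul_assoc, h.R_L, mul_assoc, ih, mul_assoc]
  induction hk : l.length generalizing m l c with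
  | zero =>
    obtain rfl := List.length_eq_zero_iff.1 hk
    simp only [lProd, List.map_nil, List.prod_nil, Module.End.one_apply]
    refine diffOp_apply_eq_zero (M := N b c) (fun n => h.L_d n a) (h.locality b c) ?_ m
    intro m
    -- The sum is `R m c (g b)`, and `L n a` passes through `R m c` to kill `g b`.
    rw [← h.right, ← Module.End.mul_apply, ← h.R_L, Module.End.mul_apply, h.locality _ _ _ hn,
      map_zero]
  | succ K ih =>
    -- The vectors killed by every `F m * lProd L l` with `l` of length `K` form a `D`-stable set.
    have stable : ∀ v : V, (∀ m l, l.length = K → F m (lProd L l v) = 0) →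
        ∀ m l, l.length = K → F m (lProd L l (D v)) = 0 := by
      intro v hv m l hl
      have e := diffOp_mul_comm (k := k) (fun n => h.L_d n a) (fun n => h.L_d n b) n 0 m
      have h2 : lProd L l (D v) = D (lProd L l v) + (lProd L l * D - D * lProd L l) v := by
        simp
      have h3 : F m ((lProd L l * D - D * lProd L l) v) = 0 := by
        have := lProd_mul_comm h.L_d l
        refine Submodule.span_induction (p := fun x _ => F m (x v) = 0) ?_ ?_ ?_ ?_ this
        · rintro _ ⟨l', hl', rfl⟩
          exact hv m l' (hl'.trans hl)
        · simp
        · intro x y _ _ hx hy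
          rw [LinearMap.add_apply, map_add, hx, hy, add_zero]
        · intro r x _ hx
          rw [LinearMap.smul_apply, map_smul, hx, smul_zero]
      rw [h2, map_add, h3, add_zero, ← Module.End.mul_apply, hF, e]
      simp only [Nat.cast_zero, zero_smul, add_zero, LinearMap.add_apply, Module.End.mul_apply,
        LinearMap.smul_apply]
      rw [← hF, hv m l hl, hv (m - 1) l hl, map_zero, smul_zero, add_zero]
    have stable' : ∀ (s : ℕ) (v : V), (∀ m l, l.length = K → F m (lProd L l v) = 0) →
        ∀ m l, l.length = K → F m (lProd L l (dividedPow k D s v)) = 0 := by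
      intro s v hv m l hl
      have : ∀ m l, l.length = K → F m (lProd L l ((D ^ s) v)) = 0 := by
        clear hl
        induction s with
        | zero => simpa using hv
        | succ s ihs =>
          rw [pow_succ', Module.End.mul_apply]
          exact stable _ ihs
      rw [dividedPow, LinearMap.smul_apply, map_smul, map_smul, this m l hl, smul_zero]
    -- The innermost letter `L p a'` is treated by descending induction on `p`, starting from `N a'
    -- c`, where locality kills it.
    have main : ∀ (a' : X) (j p : ℕ), N a' c ≤ p + j →
        ∀ m l, l.length = K → F m (lProd L l (L p a' (g c))) = 0 := by
      intro a' j
      induction j with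
      | zero =>
        intro p hp m l _
        rw [h.locality _ _ _ (by simpa using hp), map_zero, map_zero]
      | succ j ihj =>
        intro p hp m l hl
        by_cases hp' : N a' c ≤ p
        · rw [h.locality _ _ _ hp', map_zero, map_zero]
        -- Here the induction hypothesis is used for the generator `a'`. Expanding `R p c (g a')`
        -- gives `L p a' (g c)` up to sign, plus `D`-multiples of terms with larger index, already
        -- treated.
        have h0 : F m (lProd L l (R p c (g a'))) = 0 := by
          rw [← Module.End.mul_apply (lProd L l), ← hRl, Module.End.mul_apply,
            ← Module.End.mul_apply (F m), ← hRF, Module.End.mul_apply, ih m l a' hl, map_zero]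
        rw [h.right, show N a' c - p = (N a' c - p - 1) + 1 by omega, Finset.sum_range_succ',
          map_add, map_add, map_sum, map_sum, Finset.sum_eq_zero, zero_add] at h0
        · simpa [dividedPow] using h0
        · intro s _
          rw [map_smul, map_smul, stable' _ _ (ihj _ (by omega)) m l hl, smul_zero]
    obtain ⟨l', q, rfl⟩ : ∃ l' q, l = l' ++ [q] :=
      ⟨_, _, (List.dropLast_append_getLast (by rintro rfl; simp at hk)).symm⟩
    have : lProd L (l' ++ [q]) (g c) = lProd L l' (L q.1 q.2 (g c)) := by simp [lProd]
    rw [this]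
    exact main q.2 (N q.2 c) q.1 (Nat.le_add_left _ _) m l' (by simpa using hk)

end Representations

/-! ### A module of sequences over an algebra with a distinguished inner derivation. -/

section SequenceModule

variable {k : Type*} [Field k] {E X : Type*} [Ring E] [Algebra k E]

/-- The shift operator on sequences. -/
def seqShift (k E : Type*) [Field k] [Ring E] [Algebra k E] : Module.End k (ℕ → E) where
  toFun F p := F (p + 1)
  map_add' _ _ := rfl
  map_smul' _ _ := rfl

/-- Left multiplication of sequences by a fixed element. -/
def seqLeft (k : Type*) {E : Type*} [Field k] [Ring E] [Algebra k E] (x : E) :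
    Module.End k (ℕ → E) where
  toFun F p := x * F p
  map_add' _ _ := by ext; simp [mul_add]
  map_smul' _ _ := by ext; simp

/-- Right multiplication of sequences by a fixed element. -/
def seqRight (k : Type*) {E : Type*} [Field k] [Ring E] [Algebra k E] (x : E) :
    Module.End k (ℕ → E) where
  toFun F p := F p * x
  map_add' _ _ := by ext; simp [add_mul]
  map_smul' _ _ := by ext; simp

/-- The derivation `F ↦ (p ↦ -p F (p - 1))` of sequences. -/
def seqDer (k E : Type*) [Field k] [Ring E] [Algebra k E] : Module.End k (ℕ → E) where
  toFun F p := -(p : k) • F (p - 1)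
  map_add' _ _ := by ext; simp
  map_smul' r F := by ext p; simp only [Pi.smul_apply, RingHom.id_apply]; rw [smul_comm]

theorem seqShift_apply (F : ℕ → E) (p : ℕ) : seqShift k E F p = F (p + 1) := rfl

theorem seqLeft_apply (x : E) (F : ℕ → E) (p : ℕ) : seqLeft k x F p = x * F p := rfl

theorem seqRight_apply (x : E) (F : ℕ → E) (p : ℕ) : seqRight k x F p = F p * x := rfl

theorem seqDer_apply (F : ℕ → E) (p : ℕ) : seqDer k E F p = -(p : k) • F (p - 1) := rfl

theorem seqDer_pow_apply (F : ℕ → E) (s p : ℕ) :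
    (seqDer k E ^ s) F p = ((-1) ^ s * (p.descFactorial s : k)) • F (p - s) := by
  induction s generalizing p with
  | zero => simp
  | succ s ih =>
    rw [pow_succ', Module.End.mul_apply, seqDer_apply, ih, smul_smul, Nat.sub_sub, add_comm 1 s]
    rcases p with _ | p
    · simp
    · congr 1
      rw [Nat.add_sub_cancel, Nat.succ_descFactorial_succ]
      push_cast
      ring

theorem commute_seqShift_seqLeft (x : E) : Commute (seqShift k E) (seqLeft k x) := rfl

theorem commute_seqShift_seqRight (x : E) : Commute (seqShift k E) (seqRight k x) := rfl

theorem commute_seqRight_seqLeft (x y : E) : Commute (seqRight k x) (seqLeft k y) := by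
  ext F p : 2
  exact mul_assoc _ _ _

theorem seqLeft_mul_seqDer (x : E) : seqLeft k x * seqDer k E = seqDer k E * seqLeft k x := by
  ext F p : 2
  simp [seqLeft_apply, seqDer_apply]

theorem seqRight_mul_seqDer (x : E) : seqRight k x * seqDer k E = seqDer k E * seqRight k x := by
  ext F p : 2
  simp [seqRight_apply, seqDer_apply]

/-- A Weyl relation. As multiplications commute with `seqDer`, a multiplication minus the shift has
commutator `1` with it, and its powers obey the rule required of `L` and `R`. -/
theorem seqShift_mul_seqDer : seqShift k E * seqDer k E = seqDer k E * seqShift k E - 1 := by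
  ext F p : 2
  simp only [Module.End.mul_apply, LinearMap.sub_apply, Pi.sub_apply, seqShift_apply,
    seqDer_apply, Module.End.one_apply, Nat.add_sub_cancel]
  rcases p with _ | p
  · simp
  · rw [Nat.add_sub_cancel]
    push_cast
    module

theorem pow_mul_of_mul_eq_add_one {A : Type*} [Ring A] [Algebra k A] {G D : A}
    (h : G * D = D * G + 1) (n : ℕ) : G ^ n * D = D * G ^ n + (n : k) • G ^ (n - 1) := by
  induction n with
  | zero => simp
  | succ n ih =>
    rw [pow_succ, mul_assoc, h, mul_add, ← mul_assoc, ih, add_mul, mul_one, mul_assoc, ← pow_succ,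
      add_assoc, smul_mul_assoc]
    congr 1
    rcases n with _ | n
    · simp
    · simp only [Nat.add_sub_cancel, ← pow_succ]
      push_cast
      module

/-- Meant for right multiplications `x`, `x'`, left multiplications `y`, `y'` and the shift `z`. -/
theorem commute_mul_sub_pow {A : Type*} [Ring A] {x x' y y' z : A} (h1 : Commute x y)
    (h2 : Commute x y') (h3 : Commute x' y) (h4 : Commute x' y') (hy : Commute z y)
    (hy' : Commute z y') (hx : Commute z x) (hx' : Commute z x') (n m : ℕ) :
    Commute (x' * (x - z) ^ m) ((y - z) ^ n * y') := by
  have a1 : ∀ {w : A}, Commute w y → Commute w y' → Commute w z →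
      Commute w ((y - z) ^ n * y') := fun hw hw' hz =>
    ((hw.sub_right hz).pow_right n).mul_right hw'
  exact (a1 h3 h4 hx'.symm).mul_left
    (((a1 h1 h2 hx.symm).sub_left (a1 hy hy' (Commute.refl z))).pow_left m)

variable (k)

/-- The operators `L_n^a` on sequences. -/
def seqL (T : E) (κ : ℕ → X → E) (n : ℕ) (a : X) : Module.End k (ℕ → E) :=
  (seqLeft k T - seqShift k E) ^ n * seqLeft k (κ 0 a)

/-- The operators `R_n^a` on sequences. -/
def seqR (T : E) (κ : ℕ → X → E) (n : ℕ) (a : X) : Module.End k (ℕ → E) :=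
  seqRight k (κ 0 a) * (seqRight k T - seqShift k E) ^ n

/-- The generators in the module of sequences. -/
def seqGen (T : E) (κ : ℕ → X → E) (a : X) : ℕ → E := fun p => T ^ p * κ 0 a

variable {k}

theorem seqLeft_sub_mul_seqLeft {T : E} {κ : ℕ → X → E}
    (h : ∀ n a, κ (n + 1) a = T * κ n a - κ n a * T) (n : ℕ) (a : X) :
    (seqLeft k T - seqShift k E) * seqLeft k (κ n a) =
      seqLeft k (κ (n + 1) a) + seqLeft k (κ n a) * (seqLeft k T - seqShift k E) := by
  ext F p : 2
  simp only [Module.End.mul_apply, LinearMap.sub_apply, Pi.sub_apply, LinearMap.add_apply,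
    Pi.add_apply, seqLeft_apply, seqShift_apply, h]
  noncomm_ring

/-- Left multiplication by `T` minus the shift kills every generator, since `T * T ^ p = T ^ (p +
1)`; only its commutators with `κ` survive. -/
theorem seqL_seqGen {T : E} {κ : ℕ → X → E} (h : ∀ n a, κ (n + 1) a = T * κ n a - κ n a * T)
    (n : ℕ) (a b : X) : seqL k T κ n a (seqGen T κ b) = seqLeft k (κ n a) (seqGen T κ b) := by
  have h0 : (seqLeft k T - seqShift k E) (seqGen T κ b) = 0 := by
    ext p
    simp [seqLeft_apply, seqShift_apply, seqGen, pow_succ', mul_assoc]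
  unfold seqL
  induction n with
  | zero => simp
  | succ n ih =>
    rw [pow_succ', mul_assoc, Module.End.mul_apply, ih, ← Module.End.mul_apply,
      seqLeft_sub_mul_seqLeft h, LinearMap.add_apply, Module.End.mul_apply, h0, map_zero,
      add_zero]

theorem seqR_seqGen {T : E} {κ : ℕ → X → E} (h : ∀ n a, κ (n + 1) a = T * κ n a - κ n a * T)
    (n : ℕ) (a b : X) (p : ℕ) :
    seqR k T κ n b (seqGen T κ a) p = (-1 : k) ^ n • (T ^ p * κ n a * κ 0 b) := by
  have : ∀ p, ((seqRight k T - seqShift k E) ^ n) (seqGen T κ a) p =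
      (-1 : k) ^ n • (T ^ p * κ n a) := by
    induction n with
    | zero => simp [seqGen]
    | succ n ih =>
      intro p
      rw [pow_succ', Module.End.mul_apply, LinearMap.sub_apply, Pi.sub_apply, seqRight_apply,
        seqShift_apply, ih, ih, pow_succ (-1 : k), mul_smul, smul_mul_assoc, ← smul_sub, h,
        neg_one_smul, pow_succ]
      congr 1
      noncomm_ring
  rw [seqR, Module.End.mul_apply, seqRight_apply, this, smul_mul_assoc]

/-- Leibniz rule for the derivation `[T, ·]`. It turns the action of `R` on a generator into the sum
of divided powers in the defining relations. -/
theorem pow_mul_eq_sum_choose {T : E} {κ : ℕ → X → E}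
    (h : ∀ n a, κ (n + 1) a = T * κ n a - κ n a * T) (n p : ℕ) (a : X) :
    T ^ p * κ n a =
      ∑ s ∈ Finset.range (p + 1), (p.choose s : k) • (κ (n + s) a * T ^ (p - s)) := by
  induction p generalizing n with
  | zero => simp
  | succ p ih =>
    have e : T * κ n a = κ (n + 1) a + κ n a * T := by rw [h]; abel
    rw [pow_succ, mul_assoc, e, mul_add, ih, ← mul_assoc, ih n, Finset.sum_range_succ' _ (p + 1)]
    have h1 : (∑ s ∈ Finset.range (p + 1), (p.choose s : k) • (κ (n + s) a * T ^ (p - s))) * T =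
        ∑ s ∈ Finset.range (p + 1), (p.choose (s + 1) : k) • (κ (n + (s + 1)) a * T ^ (p - s)) +
          κ n a * T ^ (p + 1) := by
      have h2 := Finset.sum_range_succ (fun s => (p.choose s : k) •
        (κ (n + s) a * T ^ (p + 1 - s))) (p + 1)
      rw [Nat.choose_succ_self, Nat.cast_zero, zero_smul, add_zero] at h2
      have h3 : (∑ s ∈ Finset.range (p + 1), (p.choose s : k) •
          (κ (n + s) a * T ^ (p - s))) * T =
          ∑ s ∈ Finset.range (p + 1), (p.choose s : k) • (κ (n + s) a * T ^ (p + 1 - s)) := by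
        rw [Finset.sum_mul]
        refine Finset.sum_congr rfl fun s hs => ?_
        have : p + 1 - s = (p - s) + 1 := by have := Finset.mem_range.1 hs; omega
        rw [smul_mul_assoc, mul_assoc, ← pow_succ, this]
      rw [h3, ← h2, Finset.sum_range_succ' _ (p + 1)]
      simp
    rw [h1, ← add_assoc, ← Finset.sum_add_distrib]
    congr 1
    · refine Finset.sum_congr rfl fun s _ => ?_
      rw [show n + 1 + s = n + (s + 1) by omega, ← add_smul, Nat.choose_succ_succ,
        Nat.add_sub_add_right]
      push_cast
      rfl
    · simp

/-- The hypothesis `hN` is locality read entry by entry; the relation for `R` is the Leibniz rule,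
with the factor `p.choose s` coming from the divided power of `seqDer`. -/
theorem isGenRep_seq [CharZero k] {N : X → X → ℕ} {T : E} {κ : ℕ → X → E}
    (h : ∀ n a, κ (n + 1) a = T * κ n a - κ n a * T)
    (hN : ∀ a b n m, N a b ≤ n → κ n a * (T ^ m * κ 0 b) = 0) :
    IsGenRep N (seqDer k E) (seqL k T κ) (seqR k T κ) (seqGen T κ) where
  L_d n a := by
    have hG : (seqLeft k T - seqShift k E) * seqDer k E =
        seqDer k E * (seqLeft k T - seqShift k E) + 1 := by
      rw [sub_mul, seqLeft_mul_seqDer, seqShift_mul_seqDer, mul_sub]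
      abel
    rw [seqL, mul_assoc, seqLeft_mul_seqDer, ← mul_assoc, pow_mul_of_mul_eq_add_one (k := k) hG,
      add_mul, mul_assoc, smul_mul_assoc]
    rfl
  R_d n a := by
    have hG : (seqRight k T - seqShift k E) * seqDer k E =
        seqDer k E * (seqRight k T - seqShift k E) + 1 := by
      rw [sub_mul, seqRight_mul_seqDer, seqShift_mul_seqDer, mul_sub]
      abel
    rw [seqR, mul_assoc, pow_mul_of_mul_eq_add_one (k := k) hG, mul_add, ← mul_assoc,
      seqRight_mul_seqDer, mul_assoc, mul_smul_comm]
    rfl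
  R_L n m a b := (commute_mul_sub_pow (commute_seqRight_seqLeft _ _)
    (commute_seqRight_seqLeft _ _) (commute_seqRight_seqLeft _ _) (commute_seqRight_seqLeft _ _)
    (commute_seqShift_seqLeft _) (commute_seqShift_seqLeft _) (commute_seqShift_seqRight _)
    (commute_seqShift_seqRight _) n m).eq
  locality a b n hn := by
    rw [seqL_seqGen h]
    ext p
    exact hN a b n p hn
  right a b n := by
    ext p
    rw [seqR_seqGen h, pow_mul_eq_sum_choose (k := k) h, Finset.sum_mul, Finset.sum_apply,
      Finset.smul_sum]
    set f : ℕ → E := fun s => (-1 : k) ^ n • ((p.choose s : k) •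
      (κ (n + s) a * (T ^ (p - s) * κ 0 b))) with hf
    have e1 : ∀ s ∈ Finset.range (p + 1), (-1 : k) ^ n • ((p.choose s : k) •
      (κ (n + s) a * T ^ (p - s)) * κ 0 b) = f s := fun s _ => by
      rw [hf, smul_mul_assoc, mul_assoc]
    have e2 : ∀ s ∈ Finset.range (N a b - n), ((-1 : k) ^ (n + s) • dividedPow k (seqDer k E) s
        (seqL k T κ (n + s) a (seqGen T κ b))) p = f s := fun s _ => by
      have hs : (s.factorial : k) ≠ 0 := Nat.cast_ne_zero.2 s.factorial_ne_zero
      rw [seqL_seqGen h, Pi.smul_apply, dividedPow, LinearMap.smul_apply, Pi.smul_apply,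
        seqDer_pow_apply, hf, Nat.descFactorial_eq_factorial_mul_choose, seqLeft_apply, seqGen,
        smul_smul, smul_smul]
      dsimp only
      rw [smul_smul]
      congr 1
      have h1 : ((-1 : k) ^ s) * (-1) ^ s = 1 := by rw [← mul_pow]; simp
      rw [Nat.cast_mul, pow_add]
      linear_combination ((-1 : k) ^ n * (p.choose s : k) * ((s.factorial : k)⁻¹ * s.factorial)) *
        h1 + (-1 : k) ^ n * (p.choose s : k) * inv_mul_cancel₀ hs
    rw [Finset.sum_congr rfl e1, Finset.sum_congr rfl e2]
    -- Both sides sum the same `f` over different ranges; beyond either bound `f` vanishes, by the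
    -- binomial or by locality.
    have a1 : ∀ s, p + 1 ≤ s → f s = 0 := fun s hs => by
      simp [hf, Nat.choose_eq_zero_of_lt hs]
    have a2 : ∀ s, N a b - n ≤ s → f s = 0 := fun s hs => by
      simp only [hf]
      rw [hN _ _ _ _ (by omega)]
      simp
    rcases le_total (p + 1) (N a b - n) with hle | hle
    · exact Finset.sum_subset (Finset.range_mono hle) fun t _ ht => a1 t (by simpa using ht)
    · exact (Finset.sum_subset (Finset.range_mono hle)
        fun t _ ht => a2 t (by simpa using ht)).symm

/-- On an arbitrary sequence `seqL` acts with leading part `κ n a`; each commutator not taken leaves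
a smaller index. This is the source of triangularity. -/
theorem seqL_apply_sub_mem {T : E} {κ : ℕ → X → E}
    (h : ∀ n a, κ (n + 1) a = T * κ n a - κ n a * T) (n : ℕ) (a : X) (F : ℕ → E) :
    seqL k T κ n a F - seqLeft k (κ n a) F ∈
      Submodule.span k {x | ∃ q < n, ∃ H : ℕ → E, x = seqLeft k (κ q a) H} := by
  unfold seqL
  induction n with
  | zero => simp
  | succ n ih =>
    have e : ∀ q H, (seqLeft k T - seqShift k E) (seqLeft k (κ q a) H) =
        seqLeft k (κ (q + 1) a) H + seqLeft k (κ q a) ((seqLeft k T - seqShift k E) H) := by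
      intro q H
      rw [← Module.End.mul_apply, seqLeft_sub_mul_seqLeft h]
      rfl
    have e2 : ((seqLeft k T - seqShift k E) ^ (n + 1) * seqLeft k (κ 0 a)) F -
        seqLeft k (κ (n + 1) a) F = (seqLeft k T - seqShift k E)
          (((seqLeft k T - seqShift k E) ^ n * seqLeft k (κ 0 a)) F - seqLeft k (κ n a) F) +
          seqLeft k (κ n a) ((seqLeft k T - seqShift k E) F) := by
      rw [map_sub, e, pow_succ', mul_assoc, Module.End.mul_apply _ (_ * _)]
      abel
    rw [e2]
    refine add_mem ?_ (Submodule.subset_span ⟨n, n.lt_succ_self, _, rfl⟩)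
    refine Submodule.span_induction (p := fun x _ => (seqLeft k T - seqShift k E) x ∈ _)
      ?_ ?_ ?_ ?_ ih
    · rintro _ ⟨q, hq, H, rfl⟩
      rw [e]
      exact add_mem (Submodule.subset_span ⟨q + 1, by omega, _, rfl⟩)
        (Submodule.subset_span ⟨q, by omega, _, rfl⟩)
    · rw [map_zero]
      exact zero_mem _
    · intro x y _ _ hx hy
      rw [map_add]
      exact add_mem hx hy
    · intro r x _ hx
      rw [map_smul]
      exact Submodule.smul_mem _ _ hx

end SequenceModule

/-! ### The list model and linear independence of the normal words. -/

section WordModel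

variable (k : Type*) {X : Type*} [Field k] (N : X → X → ℕ)

/-- Whether the letter `(e, a)` may precede the given list. -/
def CanPrepend (e : ℕ) (a : X) : List (ℕ × X) → Prop
  | [] => True
  | (_, b) :: _ => e < N a b

open Classical in
/-- Prepend `(e, a)`, or send the list to zero if this is not allowed. -/
noncomputable def consOp (e : ℕ) (a : X) : Module.End k (List (ℕ × X) →₀ k) :=
  Finsupp.linearCombination k fun m =>
    if CanPrepend N e a m then Finsupp.single ((e, a) :: m) 1 else 0

/-- The sum of all ways to raise one of the exponents in a list. -/
noncomputable def raise : List (ℕ × X) → List (ℕ × X) →₀ k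
  | [] => 0
  | (e, a) :: m => consOp k N (e + 1) a (Finsupp.single m 1) + consOp k N e a (raise m)

/-- The linear extension of `raise`. -/
noncomputable def raiseOp : Module.End k (List (ℕ × X) →₀ k) :=
  Finsupp.linearCombination k (raise k N)

variable {N}

theorem consOp_single {e : ℕ} {a : X} {m : List (ℕ × X)} (h : CanPrepend N e a m) :
    consOp k N e a (Finsupp.single m 1) = Finsupp.single ((e, a) :: m) 1 := by
  simp [consOp, h]

theorem consOp_single_of_not {e : ℕ} {a : X} {m : List (ℕ × X)} (h : ¬ CanPrepend N e a m) :
    consOp k N e a (Finsupp.single m 1) = 0 := by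
  simp [consOp, h]

theorem raiseOp_single (m : List (ℕ × X)) :
    raiseOp k N (Finsupp.single m 1) = raise k N m := by
  simp [raiseOp]

theorem range_consOp_le (e : ℕ) (a : X) (w : List (ℕ × X) →₀ k) :
    consOp k N e a w ∈ Submodule.span k
      {x | ∃ m, CanPrepend N e a m ∧ x = Finsupp.single ((e, a) :: m) 1} := by
  induction w using Finsupp.induction_linear with
  | zero => simp
  | add f g hf hg => rw [map_add]; exact add_mem hf hg
  | single m r =>
    rw [← mul_one r, ← smul_eq_mul, ← Finsupp.smul_single, map_smul]
    refine Submodule.smul_mem _ _ ?_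
    by_cases h : CanPrepend N e a m
    · rw [consOp_single k h]
      exact Submodule.subset_span ⟨m, h, rfl⟩
    · rw [consOp_single_of_not k h]
      exact zero_mem _

/-- The span of the lists with head of colour `b`. -/
noncomputable def headSpan (b : X) : Submodule k (List (ℕ × X) →₀ k) :=
  Submodule.span k {x | ∃ e m, x = Finsupp.single ((e, b) :: m) 1}

theorem consOp_mem_headSpan (e : ℕ) (b : X) (w : List (ℕ × X) →₀ k) :
    consOp k N e b w ∈ headSpan k b := by
  refine Submodule.span_mono ?_ (range_consOp_le k e b w)
  rintro _ ⟨m, _, rfl⟩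
  exact ⟨e, m, rfl⟩

theorem raiseOp_mem_headSpan {b : X} {w : List (ℕ × X) →₀ k} (hw : w ∈ headSpan k b) :
    raiseOp k N w ∈ headSpan k b := by
  refine Submodule.span_le (p := (headSpan k b).comap (raiseOp k N)) |>.2 ?_ hw
  rintro _ ⟨e, m, rfl⟩
  rw [SetLike.mem_coe, Submodule.mem_comap, raiseOp_single, raise]
  exact add_mem (consOp_mem_headSpan k _ _ _) (consOp_mem_headSpan k _ _ _)

theorem consOp_eq_zero_of_mem_headSpan {a b : X} {n : ℕ} (hn : N a b ≤ n)
    {w : List (ℕ × X) →₀ k} (hw : w ∈ headSpan k b) : consOp k N n a w = 0 := by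
  refine Submodule.span_le (p := LinearMap.ker (consOp k N n a)) |>.2 ?_ hw
  rintro _ ⟨e, m, rfl⟩
  exact consOp_single_of_not k (by simpa [CanPrepend] using hn)

/-- If `(n, a)` may be prepended, this is the recursion defining `raise`. Otherwise all three terms
vanish: raising keeps the colour of the head, and the bound on `n` depends on that colour only. -/
theorem consOp_succ (n : ℕ) (a : X) :
    consOp k N (n + 1) a = raiseOp k N * consOp k N n a - consOp k N n a * raiseOp k N := by
  refine Finsupp.lhom_ext' fun m => LinearMap.ext_ring ?_
  simp only [LinearMap.comp_apply, Finsupp.lsingle_apply, LinearMap.sub_apply,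
    Module.End.mul_apply, raiseOp_single]
  by_cases h : CanPrepend N n a m
  · rw [consOp_single k h, raiseOp_single, raise, add_sub_cancel_right]
  · obtain ⟨⟨e, b⟩, m, rfl⟩ : ∃ p m', m = p :: m' := by
      cases m with
      | nil => exact absurd trivial h
      | cons p m => exact ⟨p, m, rfl⟩
    have hn : N a b ≤ n := by simpa [CanPrepend] using h
    have hm : (Finsupp.single ((e, b) :: m) 1 : List (ℕ × X) →₀ k) ∈ headSpan k b :=
      Submodule.subset_span ⟨e, m, rfl⟩
    rw [consOp_eq_zero_of_mem_headSpan k hn hm, ← raiseOp_single k (N := N),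
      consOp_eq_zero_of_mem_headSpan k hn (raiseOp_mem_headSpan k hm),
      consOp_eq_zero_of_mem_headSpan k (hn.trans n.le_succ) hm]
    simp

theorem consOp_mul_raiseOp_pow_mul_consOp (a b : X) (n m : ℕ) (hn : N a b ≤ n) :
    consOp k N n a * (raiseOp k N ^ m * consOp k N 0 b) = 0 := by
  refine LinearMap.ext fun w => ?_
  refine consOp_eq_zero_of_mem_headSpan k hn ?_
  rw [Module.End.mul_apply]
  induction m with
  | zero => exact consOp_mem_headSpan k _ _ _
  | succ m ih =>
    rw [pow_succ', Module.End.mul_apply]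
    exact raiseOp_mem_headSpan k ih

theorem raiseOp_pow_consOp_nil (p : ℕ) (c : X) :
    (raiseOp k N ^ p * consOp k N 0 c) (Finsupp.single [] 1) = Finsupp.single [(p, c)] 1 := by
  induction p with
  | zero =>
    rw [pow_zero, one_mul, consOp_single k (by trivial)]
  | succ p ih =>
    rw [pow_succ', mul_assoc, Module.End.mul_apply, ih, raiseOp_single, raise, raise, map_zero,
      add_zero, consOp_single k (by trivial)]

/-- The generator `c` plays the part of a last letter `(p, c)` with arbitrary exponent, so normality
becomes admissibility in the list model. -/
theorem isNormalSeq_cons {n : ℕ} {a : X} {l : List (ℕ × X)} {c : X} (p : ℕ) :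
    IsNormalSeq N ((n, a) :: l) c ↔ CanPrepend N n a (l ++ [(p, c)]) ∧ IsNormalSeq N l c := by
  rcases l with _ | ⟨⟨m, b⟩, l⟩ <;> simp [IsNormalSeq, CanPrepend]

/-- The list of letters, with the lexicographic order. -/
def lexKey (w : List (ℕ × X)) : List (ℕ ×ₗ X) := w.map toLex

theorem lexKey_injective : Function.Injective (lexKey : List (ℕ × X) → _) :=
  List.map_injective_iff.2 toLex.injective

variable [LinearOrder X]

/-- Triangularity by induction on `l`: the leading part `consOp` keeps the lexicographic order of
tails, and every other term starts with a smaller exponent. -/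
theorem lProd_seqGen_sub_mem {l : List (ℕ × X)} {c : X} (hl : IsNormalSeq N l c) (p : ℕ) :
    (lProd (seqL k (raiseOp k N) (consOp k N)) l (seqGen (raiseOp k N) (consOp k N) c)) p
      (Finsupp.single [] 1) - Finsupp.single (l ++ [(p, c)]) 1 ∈
      Submodule.span k {x : List (ℕ × X) →₀ k |
        ∃ w, lexKey w < lexKey (l ++ [(p, c)]) ∧ x = Finsupp.single w 1} := by
  induction l with
  | nil =>
    have := raiseOp_pow_consOp_nil k (N := N) p c
    rw [Module.End.mul_apply] at this
    simp [lProd, seqGen, this]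
  | cons q l ih =>
    obtain ⟨n, a⟩ := q
    obtain ⟨h1, h2⟩ := (isNormalSeq_cons p).1 hl
    have ih := ih h2
    set F := lProd (seqL k (raiseOp k N) (consOp k N)) l (seqGen (raiseOp k N) (consOp k N) c)
    have e : lProd (seqL k (raiseOp k N) (consOp k N)) ((n, a) :: l)
        (seqGen (raiseOp k N) (consOp k N) c) = seqL k (raiseOp k N) (consOp k N) n a F := by
      simp [lProd, F]
    set P := Submodule.span k {x : List (ℕ × X) →₀ k |
      ∃ w, lexKey w < lexKey ((n, a) :: l ++ [(p, c)]) ∧ x = Finsupp.single w 1} with hP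
    have h3 := seqL_apply_sub_mem (k := k) (consOp_succ k (N := N)) n a F
    set v : List (ℕ × X) →₀ k := Finsupp.single [] 1
    rw [e]
    have e2 : seqL k (raiseOp k N) (consOp k N) n a F p v - Finsupp.single ((n, a) :: l ++ [(p, c)]) 1
        = (seqL k (raiseOp k N) (consOp k N) n a F - seqLeft k (consOp k N n a) F) p v +
          consOp k N n a (F p v - Finsupp.single (l ++ [(p, c)]) 1) := by
      rw [map_sub, consOp_single k h1]
      simp [seqLeft_apply]
    rw [e2]
    refine add_mem ?_ ?_
    · refine Submodule.span_induction (p := fun x _ => x p v ∈ P) ?_ ?_ ?_ ?_ h3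
      · rintro _ ⟨q, hq, H, rfl⟩
        refine Submodule.span_mono ?_ (range_consOp_le k q a (H p v))
        rintro _ ⟨m, _, rfl⟩
        refine ⟨_, ?_, rfl⟩
        refine List.Lex.rel ?_
        exact Prod.Lex.toLex_lt_toLex.2 (Or.inl hq)
      · exact zero_mem _
      · intro x y _ _ hx hy
        exact add_mem hx hy
      · intro r x _ hx
        exact Submodule.smul_mem _ r hx
    · refine Submodule.span_le (p := Submodule.comap (consOp k N n a) P) |>.2 ?_ ih
      rintro _ ⟨w, hw, rfl⟩
      rw [SetLike.mem_coe, Submodule.mem_comap]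
      by_cases hc : CanPrepend N n a w
      · rw [consOp_single k hc]
        refine Submodule.subset_span ⟨_, ?_, rfl⟩
        exact List.Lex.cons hw
      · rw [consOp_single_of_not k hc]
        exact zero_mem _

theorem lProd_seqGen_apply {l : List (ℕ × X)} {c : X} (hl : IsNormalSeq N l c) (p : ℕ)
    {w : List (ℕ × X)} (hw : lexKey (l ++ [(p, c)]) ≤ lexKey w) :
    (lProd (seqL k (raiseOp k N) (consOp k N)) l (seqGen (raiseOp k N) (consOp k N) c)) p
      (Finsupp.single [] 1) w = (Finsupp.single (l ++ [(p, c)]) 1 : List (ℕ × X) →₀ k) w := by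
  have h := lProd_seqGen_sub_mem k hl p
  rw [← sub_eq_zero, ← Finsupp.sub_apply]
  refine Submodule.span_le (p := LinearMap.ker (Finsupp.lapply w)) |>.2 ?_ h
  rintro _ ⟨w', hw', rfl⟩
  rw [SetLike.mem_coe, LinearMap.mem_ker, Finsupp.lapply_apply, Finsupp.single_apply_eq_zero]
  rintro rfl
  exact absurd hw' (not_lt.2 hw)

theorem linearIndependent_normal [CharZero k] : LinearIndependent k
    fun t : {t : ℕ × List (ℕ × X) × X // IsNormalSeq N t.2.1 t.2.2} =>
      (seqDer k (Module.End k (List (ℕ × X) →₀ k)) ^ t.1.1)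
        (lProd (seqL k (raiseOp k N) (consOp k N)) t.1.2.1
          (seqGen (raiseOp k N) (consOp k N) t.1.2.2)) := by
  rw [linearIndependent_iff]
  intro f hf
  by_contra hne
  -- The order dual makes the greatest key the one with the least power of `∂`, and among these the
  -- greatest list.
  let key : {t : ℕ × List (ℕ × X) × X // IsNormalSeq N t.2.1 t.2.2} →
      ℕᵒᵈ ×ₗ List (ℕ ×ₗ X) :=
    fun t => toLex (OrderDual.toDual t.1.1, lexKey (t.1.2.1 ++ [(0, t.1.2.2)]))
  have hkey : Function.Injective key := by
    rintro ⟨⟨s, l, c⟩, hs⟩ ⟨⟨s', l', c'⟩, hs'⟩ h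
    have h1 := congrArg (fun x => (ofLex x).1) h
    have h2 := lexKey_injective (congrArg (fun x => (ofLex x).2) h)
    have h3 : s = s' := h1
    simpa [h3] using h2
  obtain ⟨t, ht, hmax⟩ := Finset.exists_max_image f.support key
    (Finsupp.support_nonempty_iff.2 hne)
  -- Entry `s` of `seqDer ^ s' F` vanishes for `s' > s` and is `± s! F 0` for `s' = s`. Hence the
  -- exponent `0` in the list whose coefficient is read.
  let φ : (ℕ → Module.End k (List (ℕ × X) →₀ k)) →ₗ[k] k :=
    Finsupp.lapply (t.1.2.1 ++ [(0, t.1.2.2)]) ∘ₗ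
      LinearMap.applyₗ (Finsupp.single [] 1) ∘ₗ LinearMap.proj t.1.1
  have hφ : ∀ F, φ F = F t.1.1 (Finsupp.single [] 1) (t.1.2.1 ++ [(0, t.1.2.2)]) := fun F => rfl
  have h0 := congrArg φ hf
  rw [map_zero, Finsupp.linearCombination_apply, Finsupp.sum, map_sum,
    Finset.sum_eq_single_of_mem t ht] at h0
  · rw [map_smul, hφ, seqDer_pow_apply, Nat.descFactorial_self, Nat.sub_self,
      LinearMap.smul_apply, Finsupp.smul_apply, lProd_seqGen_apply k t.2 0 le_rfl,
      Finsupp.single_eq_same] at h0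
    have h1 : (t.1.1.factorial : k) ≠ 0 := Nat.cast_ne_zero.2 (Nat.factorial_ne_zero _)
    simp [h1] at h0
    exact Finsupp.mem_support_iff.1 ht h0
  · intro t' ht' hne'
    have hlt : key t' < key t := lt_of_le_of_ne (hmax t' ht') (hkey.ne hne')
    rw [map_smul, hφ, seqDer_pow_apply]
    rcases Prod.Lex.toLex_lt_toLex.1 hlt with h | ⟨h, h'⟩
    · have : t.1.1 < t'.1.1 := h
      simp [Nat.descFactorial_eq_zero_iff_lt.2 this]
    · have : t'.1.1 = t.1.1 := h
      have h' : lexKey (t'.1.2.1 ++ [(0, t'.1.2.2)]) < lexKey (t.1.2.1 ++ [(0, t.1.2.2)]) := h'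
      rw [this, Nat.sub_self, LinearMap.smul_apply, Finsupp.smul_apply,
        lProd_seqGen_apply k t'.2 0 h'.le, Finsupp.single_eq_of_ne, smul_zero, smul_zero]
      rintro h2
      exact absurd (congrArg lexKey h2) h'.ne'

end WordModel

/-! ### A criterion for Gröbner–Shirshov bases through a linear map. -/

section Criterion

variable {k Z : Type*} [Field k]

theorem word_mul (u v : FreeMonoid Z) : word k (u * v) = word k u * word k v := by
  simp [word, MonoidAlgebra.single_mul_single]

theorem word_one : word k (1 : FreeMonoid Z) = 1 := rfl

theorem mem_span_word {A : Set (FreeMonoid Z)} {f : FreeAssoc k Z}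
    (hf : f ∈ Submodule.span k (word k '' A)) {w : FreeMonoid Z} (hw : f.coeff w ≠ 0) :
    w ∈ A := by
  classical
  revert hw
  refine Submodule.span_induction (p := fun f _ => f.coeff w ≠ 0 → w ∈ A) ?_ ?_ ?_ ?_ hf
  · rintro _ ⟨v, hv, rfl⟩ hw
    rw [word, MonoidAlgebra.coeff_single, Finsupp.single_apply] at hw
    obtain rfl : v = w := by
      by_contra h
      exact hw (if_neg h)
    exact hv
  · intro h
    exact absurd rfl h
  · intro x y _ _ hx hy h
    by_contra hA
    refine h ?_
    rw [MonoidAlgebra.coeff_add, Finsupp.add_apply, not_ne_iff.1 (mt hx hA),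
      not_ne_iff.1 (mt hy hA), add_zero]
  · intro c x _ hx h
    refine hx fun h0 => h ?_
    rw [MonoidAlgebra.coeff_smul, Finsupp.smul_apply, h0, smul_zero]

/-- `s` is the sum of its leading word `p` and a combination of smaller words, and the class `P`
of words is stable under replacing the subword `p` by the latter. -/
def IsLed (r : FreeMonoid Z → FreeMonoid Z → Prop) (P : FreeMonoid Z → Prop)
    (s : FreeAssoc k Z) (p : FreeMonoid Z) : Prop :=
  s - word k p ∈ Submodule.span k (word k '' {t | r t p ∧ ∀ u v, P (u * p * v) → P (u * t * v)})

variable {r : FreeMonoid Z → FreeMonoid Z → Prop} {P : FreeMonoid Z → Prop}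

theorem IsMonomialOrder.irrefl (hr : IsMonomialOrder r) (w : FreeMonoid Z) : ¬ r w w :=
  fun h => have := hr.isWellOrder; irrefl_of r w h

theorem IsMonomialOrder.trans (hr : IsMonomialOrder r) {u v w : FreeMonoid Z} (h : r u v)
    (h' : r v w) : r u w :=
  have := hr.isWellOrder; trans_of r h h'

theorem IsPrincipal.eq (hr : IsMonomialOrder r) {f : FreeAssoc k Z} {p q : FreeMonoid Z}
    (hp : IsPrincipal r f p) (hq : IsPrincipal r f q) : p = q := by
  by_contra h
  exact hr.irrefl p (hr.trans (hq.2 p hp.1 h) (hp.2 q hq.1 (Ne.symm h)))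

theorem IsLed.coeff_eq_one (hr : IsMonomialOrder r) {s : FreeAssoc k Z} {p : FreeMonoid Z}
    (h : IsLed r P s p) : s.coeff p = 1 := by
  have h1 : (s - word k p).coeff p = 0 := by
    by_contra h0
    exact hr.irrefl p (mem_span_word h h0).1
  rw [MonoidAlgebra.coeff_sub, Finsupp.sub_apply, sub_eq_zero] at h1
  rw [h1, word, MonoidAlgebra.coeff_single, Finsupp.single_eq_same]

theorem IsLed.isPrincipal (hr : IsMonomialOrder r) {s : FreeAssoc k Z} {p : FreeMonoid Z}
    (h : IsLed r P s p) : IsPrincipal r s p := by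
  refine ⟨by rw [h.coeff_eq_one hr]; exact one_ne_zero, fun v hv hvp => ?_⟩
  refine (mem_span_word h (w := v) ?_).1
  rwa [MonoidAlgebra.coeff_sub, Finsupp.sub_apply, word, MonoidAlgebra.coeff_single,
    Finsupp.single_eq_of_ne hvp, sub_zero]

theorem IsLed.isMonic (hr : IsMonomialOrder r) {s : FreeAssoc k Z} {p : FreeMonoid Z}
    (h : IsLed r P s p) : IsMonic r s :=
  ⟨p, h.isPrincipal hr, h.coeff_eq_one hr⟩

theorem IsLed.mul_mul_sub_mem (hr : IsMonomialOrder r) {s : FreeAssoc k Z} {p : FreeMonoid Z}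
    (h : IsLed r P s p) {u v w : FreeMonoid Z} (hw : w = u * p * v) (hP : P w) :
    word k u * s * word k v - word k w ∈ Submodule.span k (word k '' {t | r t w ∧ P t}) := by
  subst hw
  have e : word k u * s * word k v - word k (u * p * v) =
      (LinearMap.mulRight k (word k v) ∘ₗ LinearMap.mulLeft k (word k u)) (s - word k p) := by
    simp [word_mul, mul_sub, sub_mul]
  rw [e]
  have := Submodule.mem_map_of_mem
    (f := LinearMap.mulRight k (word k v) ∘ₗ LinearMap.mulLeft k (word k u)) h
  rw [Submodule.map_span] at this
  refine Submodule.span_mono ?_ this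
  rintro _ ⟨_, ⟨t, ⟨ht, ht'⟩, rfl⟩, rfl⟩
  exact ⟨u * t * v, ⟨hr.mul_mul u v ht, ht' u v hP⟩, by simp [word_mul]⟩

theorem IsTrivialMod.mono {S S' : Set (FreeAssoc k Z)} (h : S ⊆ S') {w : FreeMonoid Z}
    {f : FreeAssoc k Z} (hf : IsTrivialMod r S w f) : IsTrivialMod r S' w f := by
  refine Submodule.span_mono ?_ hf
  rintro _ ⟨s, hs, t, ht, u, v, huv, rfl⟩
  exact ⟨s, h hs, t, ht, u, v, huv, rfl⟩

theorem isTrivialMod_zero {S : Set (FreeAssoc k Z)} {w : FreeMonoid Z} :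
    IsTrivialMod r S w 0 :=
  zero_mem _

variable {S : Set (FreeAssoc k Z)}

/-- Reduction by well-founded induction. Each step decreases the word, so it stays below `w`, and
`IsLed` keeps it within `P`. -/
theorem word_mem_reduced_sup (hr : IsMonomialOrder r) (hS : ∀ s ∈ S, ∃ p, IsLed r P s p)
    {w : FreeMonoid Z} (t : FreeMonoid Z) (ht : r t w) (hP : P t) :
    word k t ∈ Submodule.span k (word k '' {t | P t ∧ IsReduced r S t}) ⊔
      Submodule.span k {h : FreeAssoc k Z | ∃ s ∈ S, ∃ t, IsPrincipal r s t ∧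
        ∃ u v : FreeMonoid Z, r (u * t * v) w ∧ h = word k u * s * word k v} := by
  have := hr.isWellOrder
  induction t using (IsWellFounded.wf : WellFounded r).induction with
  | _ t ih =>
    by_cases hred : IsReduced r S t
    · exact Submodule.mem_sup_left (Submodule.subset_span ⟨t, ⟨hP, hred⟩, rfl⟩)
    · unfold IsReduced at hred
      push Not at hred
      obtain ⟨s, hs, p, hp, u, v, huv⟩ := hred
      obtain ⟨p', hp'⟩ := hS s hs
      obtain rfl := hp.eq hr (hp'.isPrincipal hr)
      have h1 := hp'.mul_mul_sub_mem hr huv hP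
      rw [← sub_sub_cancel (word k u * s * word k v) (word k t)]
      refine sub_mem (Submodule.mem_sup_right (Submodule.subset_span
        ⟨s, hs, p, hp, u, v, huv ▸ ht, rfl⟩)) ?_
      refine Submodule.span_le.2 ?_ h1
      rintro _ ⟨t', ⟨ht', hP'⟩, rfl⟩
      exact ih t' ht' (hr.trans ht' ht) hP'

/-- A combination of words smaller than `w` which lies in the kernel of a linear map that kills
the ideal generated by `S` and is injective on the span of the reduced words is trivial. -/
theorem isTrivialMod_of_map_eq_zero (hr : IsMonomialOrder r) (hS : ∀ s ∈ S, ∃ p, IsLed r P s p)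
    {M : Type*} [AddCommGroup M] [Module k M] (Φ : FreeAssoc k Z →ₗ[k] M)
    (hΦ : ∀ s ∈ S, ∀ u v, Φ (word k u * s * word k v) = 0)
    (hinj : ∀ g ∈ Submodule.span k (word k '' {t | P t ∧ IsReduced r S t}), Φ g = 0 → g = 0)
    {w : FreeMonoid Z} {h : FreeAssoc k Z}
    (hh : h ∈ Submodule.span k (word k '' {t | r t w ∧ P t})) (h0 : Φ h = 0) :
    IsTrivialMod r S w h := by
  have h1 : h ∈ Submodule.span k (word k '' {t | P t ∧ IsReduced r S t}) ⊔
      Submodule.span k {h : FreeAssoc k Z | ∃ s ∈ S, ∃ t, IsPrincipal r s t ∧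
        ∃ u v : FreeMonoid Z, r (u * t * v) w ∧ h = word k u * s * word k v} := by
    refine Submodule.span_le.2 ?_ hh
    rintro _ ⟨t, ⟨ht, hP⟩, rfl⟩
    exact word_mem_reduced_sup hr hS t ht hP
  obtain ⟨g, hg, i, hi, rfl⟩ := Submodule.mem_sup.1 h1
  have h2 : Φ i = 0 := by
    refine Submodule.span_le (p := LinearMap.ker Φ) |>.2 ?_ hi
    rintro _ ⟨s, hs, _, _, u, v, _, rfl⟩
    exact hΦ s hs u v
  rw [map_add, h2, add_zero] at h0
  rw [hinj g hg h0, zero_add]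
  exact hi

/-- In a composition the two copies of the word `w` cancel, leaving smaller words of the class `P`,
and `Φ` kills it. The class `P` is needed because `Φ` will not be injective on all reduced words;
compositions outside `P` remain as hypotheses. -/
theorem isGSB_of_map_eq_zero (hr : IsMonomialOrder r) (hS : ∀ s ∈ S, ∃ p, IsLed r P s p)
    {M : Type*} [AddCommGroup M] [Module k M] (Φ : FreeAssoc k Z →ₗ[k] M)
    (hΦ : ∀ s ∈ S, ∀ u v, Φ (word k u * s * word k v) = 0)
    (hinj : ∀ g ∈ Submodule.span k (word k '' {t | P t ∧ IsReduced r S t}), Φ g = 0 → g = 0)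
    (hincl : ∀ f ∈ S, ∀ g ∈ S, ∀ p q, IsPrincipal r f p → IsPrincipal r g q →
      ∀ u v : FreeMonoid Z, p = u * q * v → ¬ P p →
        IsTrivialMod r S p (f - word k u * g * word k v))
    (hinter : ∀ f ∈ S, ∀ g ∈ S, ∀ p q, IsPrincipal r f p → IsPrincipal r g q →
      ∀ u₁ u₂ v₂ : FreeMonoid Z, u₁ ≠ 1 → u₂ ≠ 1 → v₂ ≠ 1 → p = u₁ * u₂ → q = u₂ * v₂ →
        ¬ P (u₁ * u₂ * v₂) → IsTrivialMod r S (u₁ * u₂ * v₂) (f * word k v₂ - word k u₁ * g)) :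
    IsGSB r S where
  monic f hf := (hS f hf).elim fun _ hp => hp.isMonic hr
  inclusion f hf g hg p q hp hq u v huv := by
    by_cases hP : P p
    · obtain ⟨p', hp'⟩ := hS f hf
      obtain ⟨q', hq'⟩ := hS g hg
      obtain rfl := hp.eq hr (hp'.isPrincipal hr)
      obtain rfl := hq.eq hr (hq'.isPrincipal hr)
      refine isTrivialMod_of_map_eq_zero hr hS Φ hΦ hinj ?_ ?_
      · rw [← sub_sub_sub_cancel_right _ _ (word k p)]
        refine sub_mem ?_ (hq'.mul_mul_sub_mem hr huv hP)
        simpa [word_one] using hp'.mul_mul_sub_mem hr (u := 1) (v := 1) (w := p) (by simp) hP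
      · have h1 := hΦ f hf 1 1
        rw [word_one, one_mul, mul_one] at h1
        rw [map_sub, h1, hΦ g hg, sub_zero]
    · exact hincl f hf g hg p q hp hq u v huv hP
  intersection f hf g hg p q hp hq u₁ u₂ v₂ hu₁ hu₂ hv₂ e₁ e₂ := by
    by_cases hP : P (u₁ * u₂ * v₂)
    · obtain ⟨p', hp'⟩ := hS f hf
      obtain ⟨q', hq'⟩ := hS g hg
      obtain rfl := hp.eq hr (hp'.isPrincipal hr)
      obtain rfl := hq.eq hr (hq'.isPrincipal hr)
      refine isTrivialMod_of_map_eq_zero hr hS Φ hΦ hinj ?_ ?_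
      · rw [← sub_sub_sub_cancel_right _ _ (word k (u₁ * u₂ * v₂))]
        refine sub_mem ?_ ?_
        · simpa [word_one] using hp'.mul_mul_sub_mem hr (u := 1) (v := v₂)
            (w := u₁ * u₂ * v₂) (by rw [e₁, one_mul]) hP
        · simpa [word_one] using hq'.mul_mul_sub_mem hr (u := u₁) (v := 1)
            (w := u₁ * u₂ * v₂) (by rw [e₂, mul_one, mul_assoc]) hP
      · have h1 := hΦ f hf 1 v₂
        have h2 := hΦ g hg u₁ 1
        rw [word_one, one_mul] at h1
        rw [word_one, mul_one] at h2
        rw [map_sub, h1, h2, sub_zero]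
    · exact hinter f hf g hg p q hp hq u₁ u₂ v₂ hu₁ hu₂ hv₂ e₁ e₂ hP

end Criterion

/-! ### Leading words of the relations. -/

section Linear

variable (k : Type*) {O X : Type*} [Field k]

/-- The identification `modIncl` as a linear map. -/
noncomputable def modInclLin : PreMod k O X →ₗ[k] FreeAssoc k (O ⊕ X) :=
  Finsupp.lsum k fun x =>
    LinearMap.mulRight k (word k (FreeMonoid.of (Sum.inr x))) ∘ₗ (algIncl k O X).toLinearMap

theorem modIncl_eq (f : PreMod k O X) : modIncl f = modInclLin k f := rfl

theorem algIncl_word (u : FreeMonoid O) : algIncl k O X (word k u) = word k (opWord X u) := by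
  simp [algIncl, word, opWord]

theorem modInclLin_modWord (u : FreeMonoid O) (x : X) :
    modInclLin k (modWord k u x) = word k (genWord u x) := by
  rw [← modIncl_eq, modIncl, modWord, Finsupp.sum_single_index (by simp), algIncl_word, genWord,
    word_mul]

end Linear

section Order

variable {X : Type*}

theorem degR_mul (u v : FreeMonoid (Op X)) : degR (u * v) = degR u + degR v := by
  simp [degR]

theorem degR_lWord (l : List (ℕ × X)) : degR (lWord l) = 0 := by
  simp [degR, lWord, Op.isR]

theorem degR_d_pow (s : ℕ) : degR (FreeMonoid.of (Op.d : Op X) ^ s) = 0 := by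
  induction s with
  | zero => rfl
  | succ s ih => rw [pow_succ, degR_mul, ih]; rfl

variable [LinearOrder X]

theorem OpLt.of_degR {u v : FreeMonoid (Op X)} (h : degR u < degR v) : OpLt u v := Or.inl h

theorem OpLt.of_length {u v : FreeMonoid (Op X)} (h : degR u = degR v)
    (hl : u.toList.length < v.toList.length) : OpLt u v :=
  Or.inr ⟨h, List.Shortlex.of_length_lt hl⟩

theorem OpLt.of_lt {u v w : FreeMonoid (Op X)} {o o' : Op X}
    (h : degR (FreeMonoid.of o * u) = degR (FreeMonoid.of o' * v))
    (hl : u.toList.length = v.toList.length) (ho : Op.Lt o o') :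
    OpLt (w * (FreeMonoid.of o * u)) (w * (FreeMonoid.of o' * v)) := by
  refine Or.inr ⟨?_, List.Shortlex.of_lex ?_ ?_⟩
  · simp only [degR, FreeMonoid.toList_mul, List.countP_append] at h ⊢
    rw [h]
  · simp [hl]
  · exact List.Lex.append_left _ (List.Lex.rel ho) _

end Order

theorem lWord_cons {X : Type*} (p : ℕ × X) (l : List (ℕ × X)) :
    lWord (p :: l) = FreeMonoid.of (Op.L p.1 p.2) * lWord l := rfl

/-- `w` contains a letter from `X`. -/
def HasGen {O X : Type*} (w : FreeMonoid (O ⊕ X)) : Prop := ∃ x : X, Sum.inr x ∈ w.toList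

theorem hasGen_mul {O X : Type*} (u v : FreeMonoid (O ⊕ X)) :
    HasGen (u * v) ↔ HasGen u ∨ HasGen v := by
  simp only [HasGen, FreeMonoid.toList_mul, List.mem_append, exists_or]

theorem not_hasGen_opWord {O X : Type*} (u : FreeMonoid O) : ¬ HasGen (opWord X u) := by
  rintro ⟨x, hx⟩
  simp [opWord] at hx

theorem hasGen_genWord {O X : Type*} (u : FreeMonoid O) (x : X) : HasGen (genWord u x) :=
  ⟨x, by simp [genWord]⟩

section Leading

variable {k : Type*} {X : Type*} [Field k]

/-- The leading words of the relations of `A(X)`. -/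
inductive IsAlgLead : Op X → Op X → Prop
  | L_d (n : ℕ) (a : X) : IsAlgLead (.L n a) .d
  | R_d (n : ℕ) (a : X) : IsAlgLead (.R n a) .d
  | R_L (n m : ℕ) (a b : X) : IsAlgLead (.R m b) (.L n a)

/-- The leading words of the relations in `gsbRels`. -/
inductive IsModLead (N : X → X → ℕ) : FreeMonoid (Op X) → X → Prop
  | locality (a b : X) (n : ℕ) (h : N a b ≤ n) : IsModLead N (FreeMonoid.of (.L n a)) b
  | right (a b : X) (n : ℕ) : IsModLead N (FreeMonoid.of (.R n b)) a
  | extra (a b : X) (n m : ℕ) (l : List (ℕ × X)) (c : X) (h : N a b ≤ n)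
      (hl : IsNormalSeq N l c) : IsModLead N (lWord ((n, a) :: (m, b) :: l)) c

variable [LinearOrder X]

/-- `f` is the sum of the word `p` and a combination of smaller words. -/
def IsAlgLed (f : FreeAssoc k (Op X)) (p : FreeMonoid (Op X)) : Prop :=
  f - word k p ∈ Submodule.span k (word k '' {t | OpLt t p})

/-- `f` is the sum of the word `p x` and a combination of smaller words. -/
def IsModLed (f : PreMod k (Op X) X) (p : FreeMonoid (Op X)) (x : X) : Prop :=
  f - modWord k p x ∈ Submodule.span k {h | ∃ t y, OpLt t p ∧ h = modWord k t y}

theorem sub_sub_sub_self_eq {G : Type*} [AddCommGroup G] (x y z : G) :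
    x - y - z - x = -(y + z) := by abel

theorem isAlgLed_L_d (n : ℕ) (a : X) : IsAlgLed (letter k (.L n a) * letter k .d
    - letter k .d * letter k (.L n a) - (n : k) • letter k (.L (n - 1) a))
    (FreeMonoid.of (.L n a) * FreeMonoid.of .d) := by
  rw [IsAlgLed, letter, letter, letter, ← word_mul, ← word_mul, sub_sub_sub_self_eq]
  refine neg_mem (add_mem (Submodule.subset_span ⟨_, ?_, rfl⟩)
    (Submodule.smul_mem _ _ (Submodule.subset_span ⟨_, ?_, rfl⟩)))
  · exact OpLt.of_lt (w := 1) (u := FreeMonoid.of _) (v := FreeMonoid.of _) rfl rfl (.d_L n a)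
  · exact OpLt.of_length rfl (by simp)

theorem isAlgLed_R_d (n : ℕ) (a : X) : IsAlgLed (letter k (.R n a) * letter k .d
    - letter k .d * letter k (.R n a) - (n : k) • letter k (.R (n - 1) a))
    (FreeMonoid.of (.R n a) * FreeMonoid.of .d) := by
  rw [IsAlgLed, letter, letter, letter, ← word_mul, ← word_mul, sub_sub_sub_self_eq]
  refine neg_mem (add_mem (Submodule.subset_span ⟨_, ?_, rfl⟩)
    (Submodule.smul_mem _ _ (Submodule.subset_span ⟨_, ?_, rfl⟩)))
  · exact OpLt.of_lt (w := 1) (u := FreeMonoid.of _) (v := FreeMonoid.of _) rfl rfl (.d_R n a)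
  · exact OpLt.of_length rfl (by simp)

theorem isAlgLed_R_L (n m : ℕ) (a b : X) : IsAlgLed (letter k (.R m b) * letter k (.L n a)
    - letter k (.L n a) * letter k (.R m b)) (FreeMonoid.of (.R m b) * FreeMonoid.of (.L n a)) := by
  rw [IsAlgLed, letter, letter, ← word_mul, ← word_mul, sub_sub_cancel_left]
  refine neg_mem (Submodule.subset_span ⟨_, ?_, rfl⟩)
  exact OpLt.of_lt (w := 1) (u := FreeMonoid.of _) (v := FreeMonoid.of _) rfl rfl (.L_R n m a b)

theorem exists_isAlgLed {f : FreeAssoc k (Op X)} (hf : f ∈ algRels k X) :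
    ∃ o o', IsAlgLead o o' ∧ IsAlgLed f (FreeMonoid.of o * FreeMonoid.of o') := by
  rcases hf with ⟨n, a⟩ | ⟨n, a⟩ | ⟨n, m, a, b⟩
  exacts [⟨_, _, .L_d n a, isAlgLed_L_d n a⟩, ⟨_, _, .R_d n a, isAlgLed_R_d n a⟩,
    ⟨_, _, .R_L n m a b, isAlgLed_R_L n m a b⟩]

theorem IsAlgLead.exists_mem {o o' : Op X} (h : IsAlgLead o o') :
    ∃ f ∈ algRels k X, IsAlgLed f (FreeMonoid.of o * FreeMonoid.of o') := by
  rcases h with ⟨n, a⟩ | ⟨n, a⟩ | ⟨n, m, a, b⟩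
  exacts [⟨_, .L_d n a, isAlgLed_L_d n a⟩, ⟨_, .R_d n a, isAlgLed_R_d n a⟩,
    ⟨_, .R_L n m a b, isAlgLed_R_L n m a b⟩]

variable {N : X → X → ℕ}

/-- The words in the sum may be longer than `R n b`; they are smaller because the degree in the
letters `R` is compared first. -/
theorem isModLed_right (a b : X) (n : ℕ) : IsModLed (modWord k (FreeMonoid.of (Op.R n b)) a
    - ∑ s ∈ Finset.range (N a b - n), ((-1) ^ (n + s) * (s.factorial : k)⁻¹) •
        modWord k (FreeMonoid.of Op.d ^ s * FreeMonoid.of (Op.L (n + s) a)) b)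
    (FreeMonoid.of (Op.R n b)) a := by
  rw [IsModLed, sub_sub_cancel_left]
  refine neg_mem (sum_mem fun s _ => Submodule.smul_mem _ _
    (Submodule.subset_span ⟨_, _, OpLt.of_degR ?_, rfl⟩))
  rw [degR_mul, degR_d_pow]
  exact Nat.zero_lt_one

theorem isModLed_extra (a b : X) (n m : ℕ) (l : List (ℕ × X)) (c : X) :
    IsModLed (modWord k (lWord ((n, a) :: (m, b) :: l)) c
      + ∑ q ∈ Finset.Icc 1 n, ((-1) ^ q * (n.choose q : k)) •
          modWord k (lWord ((n - q, a) :: (m + q, b) :: l)) c)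
      (lWord ((n, a) :: (m, b) :: l)) c := by
  rw [IsModLed, add_sub_cancel_left]
  refine sum_mem fun q hq => Submodule.smul_mem _ _ (Submodule.subset_span ⟨_, _, ?_, rfl⟩)
  have := Finset.mem_Icc.1 hq
  refine OpLt.of_lt (w := 1) (u := lWord ((m + q, b) :: l)) (v := lWord ((m, b) :: l)) ?_ ?_
    (.L_L _ _ a a (Or.inl (by omega)))
  · rw [degR_mul, degR_mul, degR_lWord, degR_lWord]
    rfl
  · simp [lWord]

theorem isModLed_modWord (p : FreeMonoid (Op X)) (x : X) : IsModLed (modWord k p x) p x := by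
  rw [IsModLed, sub_self]
  exact zero_mem _

theorem exists_isModLed {f : PreMod k (Op X) X} (hf : f ∈ gsbRels k N) :
    ∃ p x, IsModLead N p x ∧ IsModLed f p x := by
  rcases hf with (⟨a, b, n, h, rfl⟩ | ⟨a, b, n, rfl⟩) | ⟨a, b, n, m, l, c, h, hl, rfl⟩
  exacts [⟨_, _, .locality a b n h, isModLed_modWord _ _⟩,
    ⟨_, _, .right a b n, isModLed_right a b n⟩,
    ⟨_, _, .extra a b n m l c h hl, isModLed_extra a b n m l c⟩]

theorem IsModLead.exists_mem {p : FreeMonoid (Op X)} {x : X} (h : IsModLead N p x) :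
    ∃ f ∈ gsbRels k N, IsModLed f p x := by
  match p, x, h with
  | _, _, .locality a b n h => exact ⟨_, Or.inl (Or.inl ⟨a, b, n, h, rfl⟩), isModLed_modWord _ _⟩
  | _, _, .right a b n => exact ⟨_, Or.inl (Or.inr ⟨a, b, n, rfl⟩), isModLed_right a b n⟩
  | _, _, .extra a b n m l c h hl =>
    exact ⟨_, Or.inr ⟨a, b, n, m, l, c, h, hl, rfl⟩, isModLed_extra a b n m l c⟩

variable {r : FreeMonoid (Op X ⊕ X) → FreeMonoid (Op X ⊕ X) → Prop}

theorem IsAlgLed.isLed (hr : IsPrescribed r) {f : FreeAssoc k (Op X)} {p : FreeMonoid (Op X)}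
    (h : IsAlgLed f p) : IsLed r HasGen (algIncl k (Op X) X f) (opWord X p) := by
  rw [IsLed, ← algIncl_word, ← map_sub]
  have := Submodule.mem_map_of_mem (f := (algIncl k (Op X) X).toLinearMap) h
  rw [Submodule.map_span] at this
  refine Submodule.span_mono ?_ this
  rintro _ ⟨_, ⟨t, ht, rfl⟩, rfl⟩
  refine ⟨opWord X t, ⟨(hr.op_op _ _).2 ht, fun u v => ?_⟩, (algIncl_word k t).symm⟩
  simp only [hasGen_mul, not_hasGen_opWord, or_false]
  exact id

theorem IsModLed.isLed (hr : IsPrescribed r) {f : PreMod k (Op X) X} {p : FreeMonoid (Op X)}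
    {x : X} (h : IsModLed f p x) : IsLed r HasGen (modIncl f) (genWord p x) := by
  rw [IsLed, modIncl_eq, ← modInclLin_modWord, ← map_sub]
  have := Submodule.mem_map_of_mem (f := modInclLin k) h
  rw [Submodule.map_span] at this
  refine Submodule.span_mono ?_ this
  rintro _ ⟨_, ⟨t, y, ht, rfl⟩, rfl⟩
  refine ⟨genWord t y, ⟨(hr.gen_gen _ _ _ _).2 (Or.inl ht), fun u v _ => ?_⟩,
    (modInclLin_modWord k t y).symm⟩
  simp only [hasGen_mul, hasGen_genWord, or_true, true_or]

omit [LinearOrder X] in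
theorem isLed_word (w : FreeMonoid (Op X ⊕ X)) : IsLed r HasGen (word k w) w := by
  rw [IsLed, sub_self]
  exact zero_mem _

/-- Turns reducedness into a statement about factors of lists, free of the coefficients and of `r`.
-/
theorem isReduced_iff (hr : IsMonomialOrder r) (hr' : IsPrescribed r)
    (w : FreeMonoid (Op X ⊕ X)) :
    IsReduced r (modIncl '' gsbRels k N ∪ algIncl k (Op X) X '' algRels k X) w ↔
      (∀ o o', IsAlgLead o o' → ¬ [Sum.inl o, Sum.inl o'] <:+: w.toList) ∧
      ∀ p x, IsModLead N p x → ¬ p.toList.map Sum.inl ++ [Sum.inr x] <:+: w.toList := by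
  constructor
  · intro h
    constructor
    · rintro o o' ho ⟨u, v, huv⟩
      obtain ⟨f, hf, hp⟩ := ho.exists_mem (k := k)
      exact h _ (Or.inr ⟨f, hf, rfl⟩) _ ((hp.isLed hr').isPrincipal hr) (FreeMonoid.ofList u)
        (FreeMonoid.ofList v) (FreeMonoid.toList.injective huv.symm)
    · rintro p x hpx ⟨u, v, huv⟩
      obtain ⟨f, hf, hp⟩ := hpx.exists_mem (k := k)
      exact h _ (Or.inl ⟨f, hf, rfl⟩) _ ((hp.isLed hr').isPrincipal hr) (FreeMonoid.ofList u)
        (FreeMonoid.ofList v) (FreeMonoid.toList.injective huv.symm)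
  · rintro ⟨h1, h2⟩ _ (⟨f, hf, rfl⟩ | ⟨f, hf, rfl⟩) t ht u v rfl
    · obtain ⟨p, x, hpx, hp⟩ := exists_isModLed hf
      obtain rfl := ht.eq hr ((hp.isLed hr').isPrincipal hr)
      exact h2 p x hpx ⟨u.toList, v.toList, rfl⟩
    · obtain ⟨o, o', ho, hp⟩ := exists_isAlgLed hf
      obtain rfl := ht.eq hr ((hp.isLed hr').isPrincipal hr)
      exact h1 o o' ho ⟨u.toList, v.toList, rfl⟩

end Leading

/-! ### Words avoiding all leading words are the normal words. -/

section Normal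

variable {X : Type*} (N : X → X → ℕ)

/-- A word contains no leading word of the relations. -/
def AvoidsLeads (W : List (Op X ⊕ X)) : Prop :=
  (∀ o o', IsAlgLead o o' → ¬ [Sum.inl o, Sum.inl o'] <:+: W) ∧
    ∀ p x, IsModLead N p x → ¬ p.toList.map Sum.inl ++ [Sum.inr x] <:+: W

variable {N}

theorem avoidsLeads_cons {z : Op X ⊕ X} {W : List (Op X ⊕ X)} : AvoidsLeads N (z :: W) ↔
    AvoidsLeads N W ∧ (∀ o o', IsAlgLead o o' → ¬ [Sum.inl o, Sum.inl o'] <+: z :: W) ∧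
    ∀ p x, IsModLead N p x → ¬ p.toList.map Sum.inl ++ [Sum.inr x] <+: z :: W := by
  simp only [AvoidsLeads, List.infix_cons_iff, not_or]
  grind

theorem avoidsLeads_of_isNormalSeq {l : List (ℕ × X)} {c : X} (hl : IsNormalSeq N l c) (s : ℕ) :
    AvoidsLeads N (((FreeMonoid.of Op.d ^ s * lWord l).toList.map Sum.inl) ++ [Sum.inr c]) := by
  induction s with
  | zero =>
    rw [pow_zero, one_mul]
    induction l with
    | nil =>
      refine avoidsLeads_cons.2 ⟨⟨?_, ?_⟩, ?_, ?_⟩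
      · simp
      · simp
      · simp
      · rintro p x (⟨a, b, n, h⟩ | ⟨a, b, n⟩ | ⟨a, b, n, m, l, c, h, hl⟩) <;>
          simp [lWord]
    | cons q l ih =>
      obtain ⟨n, a⟩ := q
      have hl' : IsNormalSeq N l c := ((isNormalSeq_cons 0).1 hl).2
      change AvoidsLeads N (Sum.inl (Op.L n a) :: ((lWord l).toList.map Sum.inl ++ [Sum.inr c]))
      refine avoidsLeads_cons.2 ⟨ih hl', ?_, ?_⟩
      · rintro o o' (⟨n, a⟩ | ⟨n, a⟩ | ⟨n, m, a, b⟩) <;> rcases l with _ | ⟨⟨m', b'⟩, l⟩ <;>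
          simp [lWord]
      · intro p x hpx
        match p, x, hpx with
        | _, _, .locality a' b' n' h =>
          rcases l with _ | ⟨⟨m, b⟩, l⟩
          · have : n < N a c := hl
            simp only [FreeMonoid.toList_of, List.map_cons, List.map_nil, List.cons_append,
              List.nil_append, lWord, FreeMonoid.toList_ofList, List.cons_prefix_cons]
            grind
          · simp [lWord]
        | _, _, .right a' b' n' => simp [lWord]
        | _, _, .extra a' b' n' m' l' c' h hl' =>
          rcases l with _ | ⟨⟨m, b⟩, l⟩
          · simp [lWord]
          · have : n < N a b := hl.1
            simp only [List.map_cons, List.cons_append, lWord, FreeMonoid.toList_ofList,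
              List.cons_prefix_cons]
            grind
  | succ s ih =>
    rw [pow_succ', mul_assoc]
    refine avoidsLeads_cons.2 ⟨ih, ?_, ?_⟩
    · rintro o o' (⟨n, a⟩ | ⟨n, a⟩ | ⟨n, m, a, b⟩) <;> simp
    · rintro p x (⟨a, b, n, h⟩ | ⟨a, b, n⟩ | ⟨a, b, n, m, l, c, h, hl⟩) <;> simp [lWord]

/-- Read from the right: the tail is normal by induction, and any letter whose addition breaks
normality completes a leading word. The extra relations cover exactly the case of `L n a` before a
normal `∂`-free word of positive length. -/
theorem exists_isNormalSeq_of_avoidsLeads (u : List (Op X)) (c : X)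
    (h : AvoidsLeads N (u.map Sum.inl ++ [Sum.inr c])) :
    ∃ s l, IsNormalSeq N l c ∧ FreeMonoid.ofList u = FreeMonoid.of Op.d ^ s * lWord l := by
  induction u with
  | nil => exact ⟨0, [], trivial, rfl⟩
  | cons o u ih =>
    rw [List.map_cons, List.cons_append] at h
    obtain ⟨h1, h2, h3⟩ := avoidsLeads_cons.1 h
    obtain ⟨s, l, hl, hu⟩ := ih h1
    have hu' : u = (FreeMonoid.of Op.d ^ s * lWord l).toList := hu
    cases o with
    | d => exact ⟨s + 1, l, hl, by rw [pow_succ', mul_assoc, ← hu]; rfl⟩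
    | L n a =>
      rcases s with _ | s
      · rw [pow_zero, one_mul] at hu hu'
        refine ⟨0, (n, a) :: l, ?_, by rw [pow_zero, one_mul, lWord_cons, ← hu]; rfl⟩
        refine (isNormalSeq_cons 0).2 ⟨?_, hl⟩
        rcases l with _ | ⟨⟨m, b⟩, l⟩
        · by_contra hc
          have hc : N a c ≤ n := by simpa [CanPrepend] using hc
          refine h3 _ _ (.locality a c n hc) ?_
          simp [hu', lWord]
        · by_contra hc
          have hc : N a b ≤ n := by simpa [CanPrepend] using hc
          refine h3 _ _ (.extra a b n m l c hc ((isNormalSeq_cons 0).1 hl).2) ?_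
          simp [hu', lWord]
      · refine absurd ?_ (h2 _ _ (.L_d n a))
        rw [hu', pow_succ', mul_assoc]
        simp
    | R n a =>
      rcases s with _ | s
      · rw [pow_zero, one_mul] at hu hu'
        rcases l with _ | ⟨⟨m, b⟩, l⟩
        · refine absurd ?_ (h3 _ _ (.right c a n))
          simp [hu', lWord]
        · refine absurd ?_ (h2 _ _ (.R_L m n b a))
          simp [hu', lWord]
      · refine absurd ?_ (h2 _ _ (.R_d n a))
        rw [hu', pow_succ', mul_assoc]
        simp

end Normal

/-! ### Evaluating words in the extended alphabet. -/

section Evaluation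

variable {k X V : Type*} [Field k] [AddCommGroup V] [Module k V]

/-- The operator by which a letter acts. -/
def opAct (D : Module.End k V) (L R : ℕ → X → Module.End k V) : Op X → Module.End k V
  | .d => D
  | .L n a => L n a
  | .R n a => R n a

theorem lift_opAct_lWord (D : Module.End k V) (L R : ℕ → X → Module.End k V)
    (l : List (ℕ × X)) : FreeMonoid.lift (opAct D L R) (lWord l) = lProd L l := by
  rw [lWord, lProd, FreeMonoid.lift_ofList, List.map_map]
  rfl

theorem IsGenRep.map_gsbRels_eq_zero [CharZero k] {N : X → X → ℕ} {D : Module.End k V}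
    {L R : ℕ → X → Module.End k V} {g : X → V} (h : IsGenRep N D L R g) {V' : Type*}
    [AddCommGroup V'] [Module k V'] {ψ : PreMod k (Op X) X →ₗ[k] V'} {j : V →ₗ[k] V'}
    (hψ : ∀ u x, ψ (modWord k u x) = j (FreeMonoid.lift (opAct D L R) u (g x)))
    {f : PreMod k (Op X) X} (hf : f ∈ gsbRels k N) : ψ f = 0 := by
  rcases hf with (⟨a, b, n, hn, rfl⟩ | ⟨a, b, n, rfl⟩) | ⟨a, b, n, m, l, c, hn, hl, rfl⟩
  · rw [hψ, FreeMonoid.lift_eval_of, opAct, h.locality a b n hn, map_zero]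
  · simp only [map_sub, map_sum, map_smul, hψ, map_mul, map_pow, FreeMonoid.lift_eval_of, opAct,
      h.right, sub_eq_zero]
    refine Finset.sum_congr rfl fun s _ => ?_
    rw [mul_smul, dividedPow, LinearMap.smul_apply, map_smul, Module.End.mul_apply]
  · have h1 := h.diffOp_lProd hn m l c
    rw [diffOp_eq_sum (k := k), Finset.sum_range_succ', LinearMap.add_apply,
      LinearMap.sum_apply] at h1
    have h2 := congrArg j h1
    rw [map_add, map_zero, map_sum] at h2
    rw [← h2, map_add, add_comm, map_sum, ← Finset.Ico_add_one_right_eq_Icc,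
      Finset.sum_Ico_eq_sum_range, Nat.add_sub_cancel]
    congr 1
    · refine Finset.sum_congr rfl fun q _ => ?_
      rw [map_smul, hψ, lift_opAct_lWord, LinearMap.smul_apply, map_smul, add_comm 1 q]
      simp [lProd]
    · rw [hψ, lift_opAct_lWord]
      simp [lProd]

/-- The action of the letters from `O ⊔ X` on `V × k`: the letter `x` sends the unit of the second
component to `g x`. -/
def extAct (D : Module.End k V) (L R : ℕ → X → Module.End k V) (g : X → V) :
    Op X ⊕ X → Module.End k (V × k)
  | .inl o => LinearMap.inl k V k ∘ₗ opAct D L R o ∘ₗ LinearMap.fst k V k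
  | .inr x => LinearMap.inl k V k ∘ₗ LinearMap.toSpanSingleton k V (g x) ∘ₗ LinearMap.snd k V k

/-- The representation of `k⟨O ⊔ X⟩` on `V × k`. -/
noncomputable def extHom (D : Module.End k V) (L R : ℕ → X → Module.End k V) (g : X → V) :
    FreeAssoc k (Op X ⊕ X) →ₐ[k] Module.End k (V × k) :=
  MonoidAlgebra.lift k (Module.End k (V × k)) (FreeMonoid (Op X ⊕ X))
    (FreeMonoid.lift (extAct D L R g))

variable {D : Module.End k V} {L R : ℕ → X → Module.End k V} {g : X → V}

theorem extHom_word (w : FreeMonoid (Op X ⊕ X)) :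
    extHom D L R g (word k w) = FreeMonoid.lift (extAct D L R g) w := by
  rw [extHom, word, MonoidAlgebra.lift_single, one_smul]

theorem lift_extAct_opWord (u : FreeMonoid (Op X)) (v : V) :
    FreeMonoid.lift (extAct D L R g) (opWord X u) (v, 0) =
      (FreeMonoid.lift (opAct D L R) u v, 0) := by
  induction u using FreeMonoid.inductionOn' with
  | one => simp [opWord]
  | of_mul o u ih =>
    have ih : FreeMonoid.lift (extAct D L R g) (FreeMonoid.map Sum.inl u) (v, 0) = _ := ih
    rw [opWord, map_mul, map_mul, map_mul, Module.End.mul_apply, ih, FreeMonoid.map_of]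
    simp [extAct]

theorem extHom_genWord (u : FreeMonoid (Op X)) (x : X) (v : V) (c : k) :
    extHom D L R g (word k (genWord u x)) (v, c) =
      (c • FreeMonoid.lift (opAct D L R) u (g x), 0) := by
  rw [extHom_word, genWord, map_mul, Module.End.mul_apply, FreeMonoid.lift_eval_of, extAct]
  simp [lift_extAct_opWord]

theorem IsGenRep.extHom_modIncl [CharZero k] {N : X → X → ℕ} (h : IsGenRep N D L R g)
    {f : PreMod k (Op X) X} (hf : f ∈ gsbRels k N) : extHom D L R g (modIncl f) = 0 := by
  -- A vector `v` becomes the operator `(w, c) ↦ (c • v, 0)`, so a relation between vectors becomes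
  -- one between operators.
  let j : V →ₗ[k] Module.End k (V × k) :=
    { toFun v := LinearMap.inl k V k ∘ₗ LinearMap.toSpanSingleton k V v ∘ₗ LinearMap.snd k V k
      map_add' v w := by ext <;> simp
      map_smul' c v := by ext <;> simp }
  refine h.map_gsbRels_eq_zero (ψ := (extHom D L R g).toLinearMap ∘ₗ modInclLin k) (j := j) ?_ hf
  intro u x
  rw [LinearMap.comp_apply, modInclLin_modWord]
  refine LinearMap.ext fun v => ?_
  obtain ⟨v, c⟩ := v
  rw [AlgHom.toLinearMap_apply, extHom_genWord]
  simp [j]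

theorem IsOpRep.extHom_algIncl (h : IsOpRep (k := k) D L R) {f : FreeAssoc k (Op X)}
    (hf : f ∈ algRels k X) : extHom D L R g (algIncl k (Op X) X f) = 0 := by
  have hl : ∀ o, extHom D L R g (algIncl k (Op X) X (letter k o)) =
      LinearMap.inl k V k ∘ₗ opAct D L R o ∘ₗ LinearMap.fst k V k := by
    intro o
    rw [letter, algIncl_word, extHom_word, opWord, FreeMonoid.map_of, FreeMonoid.lift_eval_of]
    rfl
  rcases hf with ⟨n, a⟩ | ⟨n, a⟩ | ⟨n, m, a, b⟩
  · have e := fun v => LinearMap.congr_fun (h.L_d n a) v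
    ext v <;> simp [hl, opAct]
    simpa [sub_sub, sub_eq_zero] using e v
  · have e := fun v => LinearMap.congr_fun (h.R_d n a) v
    ext v <;> simp [hl, opAct]
    simpa [sub_sub, sub_eq_zero] using e v
  · have e := fun v => LinearMap.congr_fun (h.R_L n m a b) v
    ext v <;> simp [hl, opAct]
    simpa [sub_eq_zero] using e v

/-- Every letter has image in the first summand, whereas a generator reads only the second. -/
theorem extHom_nullWords {f : FreeAssoc k (Op X ⊕ X)} (hf : f ∈ nullWords k (Op X) X) :
    extHom D L R g f = 0 := by
  obtain ⟨x, z, rfl⟩ := hf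
  rw [extHom_word, map_mul, FreeMonoid.lift_eval_of, FreeMonoid.lift_eval_of]
  cases z <;> ext <;> simp [extAct]

end Evaluation

/-! ### The defining relations of the algebra form a Gröbner–Shirshov basis. -/

section AlgebraBasis

variable {k X : Type*} [Field k] [LinearOrder X]
  {r : FreeMonoid (Op X ⊕ X) → FreeMonoid (Op X ⊕ X) → Prop}

theorem isTrivialMod_algIncl (hr : IsMonomialOrder r) (hr' : IsPrescribed r)
    {w : FreeMonoid (Op X)} {h : FreeAssoc k (Op X)}
    (hh : h ∈ Submodule.span k {x | ∃ f ∈ algRels k X, ∃ p, IsAlgLed f p ∧ ∃ u v,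
      OpLt (u * p * v) w ∧ x = word k u * f * word k v}) :
    IsTrivialMod r (algIncl k (Op X) X '' algRels k X) (opWord X w) (algIncl k (Op X) X h) := by
  have := Submodule.mem_map_of_mem (f := (algIncl k (Op X) X).toLinearMap) hh
  rw [Submodule.map_span] at this
  refine Submodule.span_mono ?_ this
  rintro _ ⟨_, ⟨f, hf, p, hp, u, v, huv, rfl⟩, rfl⟩
  refine ⟨_, ⟨f, hf, rfl⟩, _, (hp.isLed hr').isPrincipal hr, opWord X u, opWord X v, ?_, ?_⟩
  · have := (hr'.op_op _ _).2 huv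
    rwa [opWord, map_mul, map_mul] at this
  · rw [AlgHom.toLinearMap_apply, map_mul, map_mul, algIncl_word, algIncl_word]

/-- The composition on `R L ∂` written through the relations themselves; `l'` and `ρ'` stand for the
letters with lowered index. -/
theorem overlap_identity {A : Type*} [Ring A] [Algebra k A] (d l l' ρ ρ' : A) (n m : k) :
    (ρ * l - l * ρ) * d - ρ * (l * d - d * l - n • l') =
      -(l * (ρ * d - d * ρ - m • ρ')) + (ρ * d - d * ρ - m • ρ') * l
      - (l * d - d * l - n • l') * ρ + d * (ρ * l - l * ρ) + m • (ρ' * l - l * ρ')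
      + n • (ρ * l' - l' * ρ) := by
  simp only [mul_sub, sub_mul, smul_sub, mul_smul_comm, smul_mul_assoc, mul_assoc]
  abel

theorem overlap_isTrivialMod (hr : IsMonomialOrder r) (hr' : IsPrescribed r) (n m : ℕ) (a b : X) :
    IsTrivialMod r (algIncl k (Op X) X '' algRels k X)
      (opWord X (FreeMonoid.of (.R m b) * FreeMonoid.of (.L n a) * FreeMonoid.of .d))
      (algIncl k (Op X) X ((letter k (.R m b) * letter k (.L n a)
        - letter k (.L n a) * letter k (.R m b)) * letter k .d -
        letter k (.R m b) * (letter k (.L n a) * letter k .d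
      - letter k .d * letter k (.L n a) - (n : k) • letter k (.L (n - 1) a)))) := by
  refine isTrivialMod_algIncl hr hr' ?_
  rw [overlap_identity _ _ _ _ (letter k (.R (m - 1) b)) _ (m : k)]
  refine add_mem (add_mem (add_mem (sub_mem (add_mem (neg_mem ?_) ?_) ?_) ?_)
    (Submodule.smul_mem _ _ ?_)) (Submodule.smul_mem _ _ ?_)
  · refine Submodule.subset_span ⟨_, .R_d m b, _, isAlgLed_R_d m b,
      FreeMonoid.of (.L n a), 1, ?_, by rw [word_one, mul_one]; rfl⟩
    exact OpLt.of_lt (w := 1) (o := .L n a) (o' := .R m b)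
      (u := FreeMonoid.of (.R m b) * FreeMonoid.of .d)
      (v := FreeMonoid.of (.L n a) * FreeMonoid.of .d) rfl rfl (.L_R n m a b)
  · refine Submodule.subset_span ⟨_, .R_d m b, _, isAlgLed_R_d m b,
      1, FreeMonoid.of (.L n a), ?_, by rw [word_one, one_mul]; rfl⟩
    exact OpLt.of_lt (w := FreeMonoid.of _) (u := FreeMonoid.of _)
      (v := FreeMonoid.of _) rfl rfl (.d_L n a)
  · refine Submodule.subset_span ⟨_, .L_d n a, _, isAlgLed_L_d n a,
      1, FreeMonoid.of (.R m b), ?_, by rw [word_one, one_mul]; rfl⟩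
    exact OpLt.of_lt (w := 1) (o := .L n a) (o' := .R m b)
      (u := FreeMonoid.of .d * FreeMonoid.of (.R m b))
      (v := FreeMonoid.of (.L n a) * FreeMonoid.of .d) rfl rfl (.L_R n m a b)
  · refine Submodule.subset_span ⟨_, .R_L n m a b, _, isAlgLed_R_L n m a b,
      FreeMonoid.of .d, 1, ?_, by rw [word_one, mul_one]; rfl⟩
    exact OpLt.of_lt (w := 1) (o := .d) (o' := .R m b)
      (u := FreeMonoid.of (.R m b) * FreeMonoid.of (.L n a))
      (v := FreeMonoid.of (.L n a) * FreeMonoid.of .d) rfl rfl (.d_R m b)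
  · refine Submodule.subset_span ⟨_, .R_L n (m - 1) a b, _, isAlgLed_R_L n (m - 1) a b,
      1, 1, ?_, by rw [word_one, one_mul, mul_one]⟩
    exact OpLt.of_length rfl (by simp)
  · refine Submodule.subset_span ⟨_, .R_L (n - 1) m a b, _, isAlgLed_R_L (n - 1) m a b,
      1, 1, ?_, by rw [word_one, one_mul, mul_one]⟩
    exact OpLt.of_length rfl (by simp)

theorem opWord_injective {O X : Type*} : Function.Injective (opWord X : FreeMonoid O → _) :=
  List.map_injective_iff.2 Sum.inl_injective

theorem eq_of_isAlgLed (hr : IsMonomialOrder r) (hr' : IsPrescribed r)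
    {f f' : FreeAssoc k (Op X)} (hf : f ∈ algRels k X) (hf' : f' ∈ algRels k X)
    {p : FreeMonoid (Op X ⊕ X)} (hp : IsPrincipal r (algIncl k (Op X) X f) p)
    (hp' : IsPrincipal r (algIncl k (Op X) X f') p) : f = f' := by
  have key : ∀ {q q' : FreeMonoid (Op X)}, IsAlgLed f q → IsAlgLed f' q' → q = q' := by
    intro q q' hq hq'
    have h1 := hp.eq hr ((hq.isLed hr').isPrincipal hr)
    have h2 := hp'.eq hr ((hq'.isLed hr').isPrincipal hr)
    exact opWord_injective (h1.symm.trans h2)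
  rcases hf with ⟨n, a⟩ | ⟨n, a⟩ | ⟨n, m, a, b⟩ <;>
    rcases hf' with ⟨n', a'⟩ | ⟨n', a'⟩ | ⟨n', m', a', b'⟩
  · have := congrArg FreeMonoid.toList (key (isAlgLed_L_d n a) (isAlgLed_L_d n' a'))
    simp at this
    grind
  · have := congrArg FreeMonoid.toList (key (isAlgLed_L_d n a) (isAlgLed_R_d n' a'))
    simp at this
  · have := congrArg FreeMonoid.toList (key (isAlgLed_L_d n a) (isAlgLed_R_L n' m' a' b'))
    simp at this
  · have := congrArg FreeMonoid.toList (key (isAlgLed_R_d n a) (isAlgLed_L_d n' a'))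
    simp at this
  · have := congrArg FreeMonoid.toList (key (isAlgLed_R_d n a) (isAlgLed_R_d n' a'))
    simp at this
    grind
  · have := congrArg FreeMonoid.toList (key (isAlgLed_R_d n a) (isAlgLed_R_L n' m' a' b'))
    simp at this
  · have := congrArg FreeMonoid.toList (key (isAlgLed_R_L n m a b) (isAlgLed_L_d n' a'))
    simp at this
  · have := congrArg FreeMonoid.toList (key (isAlgLed_R_L n m a b) (isAlgLed_R_d n' a'))
    simp at this
  · have := congrArg FreeMonoid.toList (key (isAlgLed_R_L n m a b) (isAlgLed_R_L n' m' a' b'))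
    simp at this
    grind

theorem eq_of_mul_eq_of_mul_of {Z : Type*} {z z' : Z} {u v : FreeMonoid Z} (hu : u ≠ 1)
    (hv : v ≠ 1) (h : FreeMonoid.of z * FreeMonoid.of z' = u * v) :
    u = FreeMonoid.of z ∧ v = FreeMonoid.of z' := by
  have h' : [z, z'] = u.toList ++ v.toList := h
  have hu' : u.toList ≠ [] := hu
  have hv' : v.toList ≠ [] := hv
  suffices H : u.toList = [z] ∧ v.toList = [z'] from
    ⟨FreeMonoid.toList.injective H.1, FreeMonoid.toList.injective H.2⟩
  generalize u.toList = U at *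
  generalize v.toList = W at *
  rcases U with _ | ⟨x, _ | ⟨y, U⟩⟩
  · exact absurd rfl hu'
  · simp at h'
    simp [h']
  · simp at h'
    exact absurd h'.2.2.2 hv'

/-- Leading words have length two and determine the relation, so inclusions are trivial. An overlap
needs a letter ending one leading word and starting another, which only `L` does. -/
theorem isGSB_algRels (hr : IsMonomialOrder r) (hr' : IsPrescribed r) :
    IsGSB r (algIncl k (Op X) X '' algRels k X) where
  monic := by
    rintro _ ⟨f, hf, rfl⟩
    obtain ⟨_, _, _, h⟩ := exists_isAlgLed hf
    exact (h.isLed hr').isMonic hr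
  inclusion := by
    rintro _ ⟨f, hf, rfl⟩ _ ⟨g, hg, rfl⟩ p q hp hq u v huv
    obtain ⟨o₁, o₂, _, h₁⟩ := exists_isAlgLed hf
    obtain ⟨o₃, o₄, _, h₂⟩ := exists_isAlgLed hg
    obtain rfl := hp.eq hr ((h₁.isLed hr').isPrincipal hr)
    obtain rfl := hq.eq hr ((h₂.isLed hr').isPrincipal hr)
    have hlen := congrArg (fun w => w.toList.length) huv
    simp [opWord] at hlen
    have hu : u.toList.length = 0 := by omega
    have hv : v.toList.length = 0 := by omega
    obtain rfl : u = 1 := List.length_eq_zero_iff.1 hu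
    obtain rfl : v = 1 := List.length_eq_zero_iff.1 hv
    rw [one_mul, mul_one] at huv
    rw [← huv] at hq
    rw [eq_of_isAlgLed hr hr' hf hg hp hq, word_one, one_mul, mul_one, sub_self]
    exact isTrivialMod_zero
  intersection := by
    rintro _ ⟨f, hf, rfl⟩ _ ⟨g, hg, rfl⟩ p q hp hq u₁ u₂ v₂ hu₁ hu₂ hv₂ e₁ e₂
    have key : ∀ {o₁ o₂ o₃ o₄ : Op X}, IsAlgLed f (FreeMonoid.of o₁ * FreeMonoid.of o₂) →
        IsAlgLed g (FreeMonoid.of o₃ * FreeMonoid.of o₄) →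
        o₂ = o₃ ∧ u₁ = opWord X (FreeMonoid.of o₁) ∧ u₂ = opWord X (FreeMonoid.of o₂) ∧
          v₂ = opWord X (FreeMonoid.of o₄) := by
      intro o₁ o₂ o₃ o₄ h₁ h₂
      have a₁ := ((h₁.isLed hr').isPrincipal hr).eq hr hp
      have a₂ := ((h₂.isLed hr').isPrincipal hr).eq hr hq
      obtain ⟨b₁, b₂⟩ := eq_of_mul_eq_of_mul_of hu₁ hu₂ (a₁.trans e₁)
      obtain ⟨b₃, b₄⟩ := eq_of_mul_eq_of_mul_of hu₂ hv₂ (a₂.trans e₂)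
      exact ⟨Sum.inl_injective (FreeMonoid.of_injective (b₂.symm.trans b₃)), b₁, b₂, b₄⟩
    rcases hf with ⟨n, a⟩ | ⟨n, a⟩ | ⟨n, m, a, b⟩ <;>
      rcases hg with ⟨n', a'⟩ | ⟨n', a'⟩ | ⟨n', m', a', b'⟩
    · exact absurd (key (isAlgLed_L_d n a) (isAlgLed_L_d n' a')).1 (by simp)
    · exact absurd (key (isAlgLed_L_d n a) (isAlgLed_R_d n' a')).1 (by simp)
    · exact absurd (key (isAlgLed_L_d n a) (isAlgLed_R_L n' m' a' b')).1 (by simp)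
    · exact absurd (key (isAlgLed_R_d n a) (isAlgLed_L_d n' a')).1 (by simp)
    · exact absurd (key (isAlgLed_R_d n a) (isAlgLed_R_d n' a')).1 (by simp)
    · exact absurd (key (isAlgLed_R_d n a) (isAlgLed_R_L n' m' a' b')).1 (by simp)
    · obtain ⟨h, rfl, rfl, rfl⟩ := key (isAlgLed_R_L n m a b) (isAlgLed_L_d n' a')
      cases h
      rw [← algIncl_word, ← algIncl_word, ← map_mul (algIncl k (Op X) X),
        ← map_mul (algIncl k (Op X) X), ← map_sub]
      exact overlap_isTrivialMod hr hr' n m a b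
    · exact absurd (key (isAlgLed_R_L n m a b) (isAlgLed_R_d n' a')).1 (by simp)
    · exact absurd (key (isAlgLed_R_L n m a b) (isAlgLed_R_L n' m' a' b')).1 (by simp)

end AlgebraBasis

/-! ### Both sets of relations present the same module. -/

section Presentation

variable {k X : Type*} [Field k]

theorem mk_eq_zero {O : Type*} {Sig : Set (FreeAssoc k O)} {f : FreeAssoc k O} (hf : f ∈ Sig) :
    Presented.mk Sig f = 0 := by
  have : Presented.mk Sig f = Presented.mk Sig 0 := RingQuot.mkAlgHom_rel k ⟨hf, rfl⟩
  rw [this, map_zero]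

/-- The projection from `k⟨O⟩ ⊗ kX` onto a presented module. -/
noncomputable def presentedModMk {O : Type*} (Sig : Set (FreeAssoc k O))
    (S : Set (PreMod k O X)) : PreMod k O X →ₗ[k] PresentedMod Sig S :=
  (relSubmodule Sig S).mkQ.restrictScalars k ∘ₗ
    Finsupp.mapRange.linearMap (Presented.mk Sig).toLinearMap

theorem presentedModMk_eq_zero {O : Type*} {Sig : Set (FreeAssoc k O)}
    {S : Set (PreMod k O X)} {f : PreMod k O X} :
    presentedModMk Sig S f = 0 ↔ toFreeMod Sig f ∈ relSubmodule Sig S :=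
  Submodule.Quotient.mk_eq_zero _

theorem presentedModMk_of_mem {O : Type*} (Sig : Set (FreeAssoc k O)) {S : Set (PreMod k O X)}
    {f : PreMod k O X} (hf : f ∈ S) : presentedModMk Sig S f = 0 :=
  presentedModMk_eq_zero.2 (Submodule.subset_span ⟨f, hf, rfl⟩)

/-- The operator by which a letter acts on a presented module. -/
noncomputable def letterAct (S : Set (PreMod k (Op X) X)) (o : Op X) :
    Module.End k (PresentedMod (algRels k X) S) :=
  Algebra.lsmul k k (PresentedMod (algRels k X) S) (Presented.mk (algRels k X) (letter k o))

/-- The generators of a presented module. -/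
noncomputable def presentedGen (S : Set (PreMod k (Op X) X)) (x : X) :
    PresentedMod (algRels k X) S :=
  (relSubmodule (algRels k X) S).mkQ (Finsupp.single x 1)

theorem presentedModMk_modWord (S : Set (PreMod k (Op X) X)) (u : FreeMonoid (Op X)) (x : X) :
    presentedModMk (algRels k X) S (modWord k u x) =
      FreeMonoid.lift (opAct (letterAct S .d) (fun n a => letterAct S (.L n a))
        fun n a => letterAct S (.R n a)) u (presentedGen S x) := by
  have h : ∀ u : FreeMonoid (Op X), FreeMonoid.lift (opAct (letterAct S .d)
      (fun n a => letterAct S (.L n a)) fun n a => letterAct S (.R n a)) u =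
      Algebra.lsmul k k (PresentedMod (algRels k X) S)
        (Presented.mk (algRels k X) (word k u)) := by
    intro u
    induction u using FreeMonoid.inductionOn' with
    | one => rw [map_one, word_one, map_one, map_one]
    | of_mul o u ih =>
      rw [map_mul, ih, word_mul, map_mul, map_mul, FreeMonoid.lift_eval_of]
      cases o <;> rfl
  rw [h, presentedGen, Algebra.lsmul_coe]
  dsimp only
  rw [← map_smul, Finsupp.smul_single, smul_eq_mul, mul_one,
    presentedModMk, modWord, LinearMap.comp_apply, Finsupp.mapRange.linearMap_apply,
    Finsupp.mapRange_single]
  rfl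

theorem isGenRep_presented (N : X → X → ℕ) :
    IsGenRep N (letterAct (moduleRels k N) .d) (fun n a => letterAct (moduleRels k N) (.L n a))
      (fun n a => letterAct (moduleRels k N) (.R n a)) (presentedGen (moduleRels k N)) where
  L_d n a := by
    have h := congrArg (Algebra.lsmul k k (PresentedMod (algRels k X) (moduleRels k N)))
      (mk_eq_zero (Sig := algRels k X) (AlgRel.L_d n a))
    simp only [map_sub, map_mul, map_smul, map_zero] at h
    rw [sub_sub, sub_eq_zero] at h
    exact h
  R_d n a := by
    have h := congrArg (Algebra.lsmul k k (PresentedMod (algRels k X) (moduleRels k N)))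
      (mk_eq_zero (Sig := algRels k X) (AlgRel.R_d n a))
    simp only [map_sub, map_mul, map_smul, map_zero] at h
    rw [sub_sub, sub_eq_zero] at h
    exact h
  R_L n m a b := by
    have h := congrArg (Algebra.lsmul k k (PresentedMod (algRels k X) (moduleRels k N)))
      (mk_eq_zero (Sig := algRels k X) (AlgRel.R_L n m a b))
    simp only [map_sub, map_mul, map_zero] at h
    exact sub_eq_zero.1 h
  locality a b n hn := by
    have h := presentedModMk_of_mem (algRels k X) (S := moduleRels k N)
      (Or.inl ⟨a, b, n, hn, rfl⟩)
    rw [presentedModMk_modWord, FreeMonoid.lift_eval_of] at h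
    exact h
  right a b n := by
    have h := presentedModMk_of_mem (algRels k X) (S := moduleRels k N)
      (Or.inr ⟨a, b, n, rfl⟩)
    simp only [map_sub, map_sum, map_smul, presentedModMk_modWord, map_mul, map_pow,
      FreeMonoid.lift_eval_of, opAct, sub_eq_zero] at h
    refine h.trans (Finset.sum_congr rfl fun s _ => ?_)
    rw [mul_smul, dividedPow, LinearMap.smul_apply, Module.End.mul_apply]

/-- The presented module is itself a representation with generators as in `IsGenRep`, so the extra
relations hold in it. -/
theorem relSubmodule_gsbRels [CharZero k] (N : X → X → ℕ) :
    relSubmodule (algRels k X) (gsbRels k N) = relSubmodule (algRels k X) (moduleRels k N) := by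
  refine le_antisymm (Submodule.span_le.2 ?_)
    (Submodule.span_mono (Set.image_mono Set.subset_union_left))
  rintro _ ⟨f, hf, rfl⟩
  exact presentedModMk_eq_zero.1 ((isGenRep_presented N).map_gsbRels_eq_zero (j := LinearMap.id)
    (presentedModMk_modWord _) hf)

end Presentation

/-! ### The basis property in the extended alphabet. -/

section Extension

variable {k X : Type*} [Field k] [LinearOrder X]
  {r : FreeMonoid (Op X ⊕ X) → FreeMonoid (Op X ⊕ X) → Prop}

theorem isReduced_genWord_iff {N : X → X → ℕ} (hr : IsMonomialOrder r) (hr' : IsPrescribed r)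
    (u : FreeMonoid (Op X)) (x : X) :
    IsReduced r (modIncl '' gsbRels k N ∪ algIncl k (Op X) X '' algRels k X) (genWord u x) ↔
      genWord u x ∈ normalWords N := by
  have e : ∀ (u : FreeMonoid (Op X)) (x : X),
      (genWord u x).toList = u.toList.map Sum.inl ++ [Sum.inr x] := fun _ _ => rfl
  rw [isReduced_iff hr hr', ← AvoidsLeads]
  constructor
  · intro h
    obtain ⟨s, l, hl, hu⟩ := exists_isNormalSeq_of_avoidsLeads u.toList x h
    exact ⟨s, l, x, hl, congrArg (genWord · x) hu⟩
  · rintro ⟨s, l, c, hl, hu⟩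
    rw [hu]
    exact avoidsLeads_of_isNormalSeq hl s

theorem exists_eq_genWord {O X : Type*} {w : FreeMonoid (O ⊕ X)} (hw : HasGen w)
    (h : ∀ (x : X) (z : O ⊕ X), ¬ [Sum.inr x, z] <:+: w.toList) : ∃ u x, w = genWord u x := by
  suffices H : ∀ W : List (O ⊕ X), (∃ x : X, Sum.inr x ∈ W) →
      (∀ (x : X) (z : O ⊕ X), ¬ [Sum.inr x, z] <:+: W) →
      ∃ (u : List O) (x : X), W = u.map Sum.inl ++ [Sum.inr x] by
    obtain ⟨u, x, hu⟩ := H w.toList hw h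
    exact ⟨FreeMonoid.ofList u, x, FreeMonoid.toList.injective hu⟩
  intro W
  induction W with
  | nil => simp
  | cons z W ih =>
    intro hW h
    rcases z with o | x
    · obtain ⟨x, hx⟩ := hW
      obtain ⟨u, y, rfl⟩ := ih ⟨x, by simpa using hx⟩
        fun x z hz => h x z (hz.trans (List.infix_cons List.infix_rfl))
      exact ⟨o :: u, y, rfl⟩
    · rcases W with _ | ⟨z, W⟩
      · exact ⟨[], x, rfl⟩
      · exact absurd ⟨[], W, rfl⟩ (h x z)

theorem isGSB_extension [CharZero k] (N : X → X → ℕ) (hr : IsMonomialOrder r)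
    (hr' : IsPrescribed r) : IsGSB r (modIncl '' gsbRels k N ∪ algIncl k (Op X) X '' algRels k X ∪
      nullWords k (Op X) X) := by
  have hN := isGenRep_seq (k := k) (N := N) (consOp_succ k (N := N))
    fun a b n m hn => consOp_mul_raiseOp_pow_mul_consOp k a b n m hn
  set T := raiseOp k N
  set κ := consOp k N
  set D := seqDer k (Module.End k (List (ℕ × X) →₀ k))
  have hS : ∀ s ∈ modIncl '' gsbRels k N ∪ algIncl k (Op X) X '' algRels k X ∪
      nullWords k (Op X) X, ∃ p, IsLed r HasGen s p := by
    rintro _ ((⟨f, hf, rfl⟩ | ⟨f, hf, rfl⟩) | ⟨x, z, rfl⟩)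
    · obtain ⟨p, x, _, h⟩ := exists_isModLed hf
      exact ⟨_, h.isLed hr'⟩
    · obtain ⟨_, _, _, h⟩ := exists_isAlgLed hf
      exact ⟨_, h.isLed hr'⟩
    · exact ⟨_, isLed_word _⟩
  have hker : ∀ s ∈ modIncl '' gsbRels k N ∪ algIncl k (Op X) X '' algRels k X ∪
      nullWords k (Op X) X, extHom D (seqL k T κ) (seqR k T κ) (seqGen T κ) s = 0 := by
    rintro _ ((⟨f, hf, rfl⟩ | ⟨f, hf, rfl⟩) | hs)
    exacts [hN.extHom_modIncl hf, hN.toIsOpRep.extHom_algIncl hf, extHom_nullWords hs]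
  -- Compositions at words without generators involve algebra relations only and are settled by
  -- `isGSB_algRels`.
  have halg : ∀ s ∈ modIncl '' gsbRels k N ∪ algIncl k (Op X) X '' algRels k X ∪
      nullWords k (Op X) X, ∀ p, IsPrincipal r s p → ¬ HasGen p →
        s ∈ algIncl k (Op X) X '' algRels k X := by
    rintro _ ((⟨f, hf, rfl⟩ | hs) | ⟨x, z, rfl⟩) p hp hgen
    · obtain ⟨q, x, _, h⟩ := exists_isModLed hf
      obtain rfl := hp.eq hr ((h.isLed hr').isPrincipal hr)
      exact absurd (hasGen_genWord q x) hgen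
    · exact hs
    · obtain rfl := hp.eq hr ((isLed_word _).isPrincipal hr)
      exact absurd ⟨x, by simp⟩ hgen
  have hA := isGSB_algRels (k := k) hr hr'
  have hsub : algIncl k (Op X) X '' algRels k X ⊆ modIncl '' gsbRels k N ∪
      algIncl k (Op X) X '' algRels k X ∪ nullWords k (Op X) X :=
    fun _ h => Or.inl (Or.inr h)
  -- Applying operators to `(0, 1)` sends `u x` to the value of `u` on the generator `x`. Nonempty
  -- words without generators are killed, hence the restriction to `HasGen`.
  refine isGSB_of_map_eq_zero (P := HasGen) hr hS
    (LinearMap.applyₗ ((0, 1) : (ℕ → Module.End k (List (ℕ × X) →₀ k)) × k) ∘ₗ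
      (extHom D (seqL k T κ) (seqR k T κ) (seqGen T κ)).toLinearMap) ?_ ?_ ?_ ?_
  · intro s hs u v
    simp [hker s hs]
  · intro f hf h0
    set ν : {t : ℕ × List (ℕ × X) × X // IsNormalSeq N t.2.1 t.2.2} → FreeMonoid (Op X ⊕ X) :=
      fun t => genWord (FreeMonoid.of Op.d ^ t.1.1 * lWord t.1.2.1) t.1.2.2 with hν
    -- A reduced word with a generator has nothing after it, since all `x z` are excluded; so it is
    -- some `u x`, and then normal.
    have hf' : f ∈ Submodule.span k (Set.range fun t => word k (ν t)) := by
      refine Submodule.span_mono ?_ hf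
      rintro _ ⟨w, ⟨hw, hred⟩, rfl⟩
      obtain ⟨u, x, rfl⟩ := exists_eq_genWord hw fun x z ⟨a, b, hab⟩ =>
        hred _ (Or.inr ⟨x, z, rfl⟩) _ ((isLed_word _).isPrincipal hr) (FreeMonoid.ofList a)
          (FreeMonoid.ofList b) (FreeMonoid.toList.injective hab.symm)
      obtain ⟨s, l, c, hl, hu⟩ := (isReduced_genWord_iff (k := k) hr hr' u x).1
        fun s hs => hred s (Or.inl hs)
      exact ⟨⟨(s, l, c), hl⟩, congrArg (word k) hu.symm⟩
    obtain ⟨c, rfl⟩ := Finsupp.mem_span_range_iff_exists_finsupp.1 hf'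
    have h1 : Finsupp.linearCombination k (fun t : {t : ℕ × List (ℕ × X) × X //
        IsNormalSeq N t.2.1 t.2.2} => (D ^ t.1.1)
          (lProd (seqL k T κ) t.1.2.1 (seqGen T κ t.1.2.2))) c = 0 := by
      have h2 := congrArg Prod.fst h0
      rw [Finsupp.sum, map_sum, Prod.fst_sum] at h2
      rw [Finsupp.linearCombination_apply, Finsupp.sum]
      refine Eq.trans ?_ h2
      refine Finset.sum_congr rfl fun t _ => ?_
      rw [map_smul, LinearMap.comp_apply, AlgHom.toLinearMap_apply]
      change _ = (c t • extHom D (seqL k T κ) (seqR k T κ) (seqGen T κ) (word k (ν t)) (0, 1)).1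
      rw [hν, extHom_genWord, one_smul, map_mul, map_pow, FreeMonoid.lift_eval_of,
        lift_opAct_lWord]
      rfl
    rw [linearIndependent_iff.1 (linearIndependent_normal k) c h1, Finsupp.sum_zero_index]
  · intro f hf g hg p q hp hq u v huv hP
    have hq' : ¬ HasGen q := fun h => hP (by rw [huv, hasGen_mul, hasGen_mul]; simp [h])
    exact (hA.inclusion f (halg f hf p hp hP) g (halg g hg q hq hq') p q hp hq u v huv).mono hsub
  · intro f hf g hg p q hp hq u₁ u₂ v₂ hu₁ hu₂ hv₂ e₁ e₂ hP
    have hp' : ¬ HasGen p := fun h => hP (by rw [hasGen_mul, ← e₁]; exact Or.inl h)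
    have hq' : ¬ HasGen q := fun h => hP (by rw [mul_assoc, hasGen_mul, ← e₂]; exact Or.inr h)
    exact (hA.intersection f (halg f hf p hp hp') g (halg g hg q hq hq') p q hp hq u₁ u₂ v₂
      hu₁ hu₂ hv₂ e₁ e₂).mono hsub

end Extension

end ConformalGSB

open ConformalGSB in
theorem mainTheorem2 {k X : Type*} [Field k] [CharZero k] [LinearOrder X] [WellFoundedLT X]
    (N : X → X → ℕ)
    (r : FreeMonoid (Op X ⊕ X) → FreeMonoid (Op X ⊕ X) → Prop)
    (hr : IsMonomialOrder r) (hr' : IsPrescribed r) :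
    IsGSBOf r (algRels k X) (moduleRels k N) (gsbRels k N) ∧
      {w : FreeMonoid (Op X ⊕ X) | (∃ u x, w = genWord u x) ∧
        IsReduced r (modIncl '' gsbRels k N ∪ algIncl k (Op X) X '' algRels k X) w} =
        normalWords N := by
  refine ⟨⟨⟨isGSB_algRels hr hr', isGSB_extension N hr hr'⟩, ?_⟩, ?_⟩
  · rw [Submodule.ker_mkQ, relSubmodule_gsbRels]
  · ext w
    constructor
    · rintro ⟨⟨u, x, rfl⟩, h⟩
      exact (isReduced_genWord_iff hr hr' u x).1 h
    · intro h
      obtain ⟨s, l, c, hl, rfl⟩ := id h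
      exact ⟨⟨_, _, rfl⟩, (isReduced_genWord_iff hr hr' _ _).2 h⟩
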